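/- Let $\theta>0$, $x_+=\max(x,0)$, $c(x)=(1+\theta x_+)^{-1/2}$, $\phi(x)=\int_0^x c(y)^{-1}\,dy$, $v^{>}=c^{1/2}e^{-i\phi}$ and $v^{<}=c^{1/2}e^{i\phi}$. For $\sigma\in\mathbb R$ consider on $\mathbb R$ the equation $$u''+(1+i\sigma)^2(1+\theta x_+)\,u=0,\qquad u:\mathbb R\to\mathbb C .\tag{$E_\sigma$}$$ Let $\mathcal U^{>}_{+\infty}$ (waves outgoing to $+\infty$) be the space of solutions $u$ of $(E_0)$ for which there are solutions $u(\cdot;\sigma)$ of $(E_\sigma)$, $\sigma<0$, with $u(x;\sigma)\to0$ as $x\to+\infty$ for every $\sigma<0$ and $u(\cdot;\sigma)\to u$ uniformly on compact subsets of $\mathbb R$ as $\sigma\to0^-$. Let $\mathcal U^{<}_{+\infty}$ (waves incoming from $+\infty$) be defined in the same way with $\sigma>0$, $\sigma\to0^+$. Let $\mathcal U^{<}_{-\infty}$ (waves outgoing to $-\infty$; $\sigma<0$, $\sigma\to 0^-$) and $\mathcal U^{>}_{-\infty}$ (waves incoming from $-\infty$; $\sigma>0$, $\sigma\to0^+$)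 be defined in the same way with decay as $x\to-\infty$. Denote by $u^{>}_{\pm\infty}\in\mathcal U^{>}_{\pm\infty}$, respectively $u^{<}_{\pm\infty}\in\mathcal U^{<}_{\pm\infty}$, the element with $u/v^{>}\to1$, respectively $u/v^{<}\to1$, as $x\to\pm\infty$. The reflection coefficient is $R=A/B$, where $u^{>}_{+\infty}=A\,u^{<}_{-\infty}+B\,u^{>}_{-\infty}$ with $B\neq0$. Let $\mathrm{Ai}$ be the (entire) Airy function, $w_\pm(X)=\mathrm{Ai}(e^{\pm i\pi/3}X)$ and $\beta=\theta^{-2/3}$. Then there is exactly one solution of $(E_0)$ on $\mathbb R$ that equals $w_+(\beta(1+\theta x))$ for $x\ge0$; it is nonzero and spans $\mathcal U^{>}_{+\infty}$. Likewise there is exactly one solution of $(E_0)$ on $\mathbb R$ that equals $w_-(\beta(1+\theta x))$ for $x\ge0$; it is nonzero and spans $\mathcal U^{<}_{+\infty}$. Moreover $-w_+'(\beta)+i\beta^{1/2}w_+(\beta)\neq0$, and the reflection coefficient exists, is unique and equals $$R=\frac{w_+'(\beta)+i\beta^{1/2}w_+(\beta)}{-w_+'(\beta)+i\beta^{1/2}w_+(\beta)}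 .$$ -/

import Mathlib

open Filter Topology

noncomputable section

namespace RampReflection

/-! ### The model equation -/

/-- The squared slowness `c⁻²(x) = 1 + θ x₊ ^ α` of the fractional ramp model. -/
def invSpeedSq (α θ x : ℝ) : ℝ := 1 + θ * (max x 0) ^ α

/-- The wave speed `c(x) = (1 + θ x₊ ^ α) ^ (-1/2)`. -/
def speed (α θ x : ℝ) : ℝ := 1 / Real.sqrt (invSpeedSq α θ x)

/-- `u` is a (classical) solution on the whole real line of the extended equation
`u'' + (1 + iσ)² c⁻² u = 0`.  For `σ = 0` this is the model equation `u'' + c⁻² u = 0`. -/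
def IsSolution (α θ σ : ℝ) (u : ℝ → ℂ) : Prop :=
  Differentiable ℝ u ∧
    ∀ x : ℝ, HasDerivAt (deriv u)
      (-((1 + Complex.I * (σ : ℂ)) ^ 2 * (invSpeedSq α θ x : ℂ) * u x)) x

lemma IsSolution.zero (α θ σ : ℝ) : IsSolution α θ σ 0 := by
  have h : deriv (0 : ℝ → ℂ) = fun _ => 0 := by
    funext x
    exact (hasDerivAt_const x (0 : ℂ)).deriv
  refine ⟨differentiable_const (0 : ℂ), fun x => ?_⟩
  rw [h]
  simpa using hasDerivAt_const x (0 : ℂ)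

lemma IsSolution.add {α θ σ : ℝ} {u v : ℝ → ℂ} (hu : IsSolution α θ σ u)
    (hv : IsSolution α θ σ v) : IsSolution α θ σ (u + v) := by
  have h : deriv (u + v) = deriv u + deriv v := by
    funext x
    exact deriv_add (hu.1 x) (hv.1 x)
  refine ⟨hu.1.add hv.1, fun x => ?_⟩
  rw [h]
  refine ((hu.2 x).add (hv.2 x)).congr_deriv ?_
  rw [Pi.add_apply]
  ring

lemma IsSolution.smul {α θ σ : ℝ} {u : ℝ → ℂ} (a : ℂ) (hu : IsSolution α θ σ u) :
    IsSolution α θ σ (a • u) := by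
  have h : deriv (a • u) = a • deriv u := by
    funext x
    exact ((hu.1 x).hasDerivAt.const_smul a).deriv
  refine ⟨hu.1.const_smul a, fun x => ?_⟩
  rw [h]
  refine ((hu.2 x).const_smul a).congr_deriv ?_
  rw [Pi.smul_apply, smul_eq_mul, smul_eq_mul]
  ring

/-! ### Polarized waves (limiting absorption) -/

/-- The space of solutions `u` of the model equation that are limits, uniformly on compact subsets
of `ℝ`, as `σ → 0` within `S`, of solutions `U σ` of the extended equation (`σ ∈ S`) with
`U σ x → 0` as `x` tends to the end `l` of the real line. -/
def polarizedSpace (α θ : ℝ) (S : Set ℝ) (l : Filter ℝ) : Submodule ℂ (ℝ → ℂ) where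
  carrier := {u | IsSolution α θ 0 u ∧ ∃ U : ℝ → ℝ → ℂ,
    (∀ σ ∈ S, IsSolution α θ σ (U σ) ∧ Tendsto (U σ) l (𝓝 0)) ∧
    ∀ K : Set ℝ, IsCompact K → TendstoUniformlyOn U u (𝓝[S] 0) K}
  zero_mem' := ⟨IsSolution.zero α θ 0, fun _ => 0,
    fun σ _ => ⟨IsSolution.zero α θ σ, tendsto_const_nhds⟩,
    fun _ _ s hs => Eventually.of_forall fun _ _ _ => refl_mem_uniformity hs⟩
  add_mem' := by
    rintro u v ⟨hu, U, hU, hUl⟩ ⟨hv, V, hV, hVl⟩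
    refine ⟨hu.add hv, fun σ => U σ + V σ, fun σ hσ => ⟨(hU σ hσ).1.add (hV σ hσ).1, ?_⟩,
      fun K hK => (hUl K hK).add (hVl K hK)⟩
    rw [← add_zero (0 : ℂ)]
    exact (hU σ hσ).2.add (hV σ hσ).2
  smul_mem' := by
    rintro a u ⟨hu, U, hU, hUl⟩
    refine ⟨hu.smul a, fun σ => a • U σ, fun σ hσ => ⟨(hU σ hσ).1.smul a, ?_⟩,
      fun K hK => (uniformContinuous_const_smul a).comp_tendstoUniformlyOn (hUl K hK)⟩
    rw [← smul_zero a]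
    exact (hU σ hσ).2.const_smul a

/-- `𝒰^>_{+∞}`: the waves outgoing to `+∞` (`σ → 0⁻`, decay at `+∞`). -/
def outgoingAtTop (α θ : ℝ) : Submodule ℂ (ℝ → ℂ) := polarizedSpace α θ (Set.Iio 0) atTop

/-- `𝒰^<_{+∞}`: the waves incoming from `+∞` (`σ → 0⁺`, decay at `+∞`). -/
def incomingAtTop (α θ : ℝ) : Submodule ℂ (ℝ → ℂ) := polarizedSpace α θ (Set.Ioi 0) atTop

/-- `𝒰^<_{-∞}`: the waves outgoing to `-∞` (`σ → 0⁻`, decay at `-∞`). -/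
def outgoingAtBot (α θ : ℝ) : Submodule ℂ (ℝ → ℂ) := polarizedSpace α θ (Set.Iio 0) atBot

/-- `𝒰^>_{-∞}`: the waves incoming from `-∞` (`σ → 0⁺`, decay at `-∞`). -/
def incomingAtBot (α θ : ℝ) : Submodule ℂ (ℝ → ℂ) := polarizedSpace α θ (Set.Ioi 0) atBot

/-! ### WKB functions, normalized waves, reflection coefficient -/

/-- The phase `φ(x) = ∫₀ˣ c(y)⁻¹ dy`. -/
def phase (α θ x : ℝ) : ℝ := ∫ y in (0 : ℝ)..x, 1 / speed α θ y

/-- The right-going WKB function `v^>(x) = c(x)^{1/2} e^{-iφ(x)}`. -/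
def wkbRight (α θ x : ℝ) : ℂ :=
  (Real.sqrt (speed α θ x) : ℂ) * Complex.exp (-(Complex.I * (phase α θ x : ℂ)))

/-- The left-going WKB function `v^<(x) = c(x)^{1/2} e^{iφ(x)}`. -/
def wkbLeft (α θ x : ℝ) : ℂ :=
  (Real.sqrt (speed α θ x) : ℂ) * Complex.exp (Complex.I * (phase α θ x : ℂ))

/-- `u` is the normalized outgoing wave `u^>_{+∞}`. -/
def IsNormalizedOutgoingAtTop (α θ : ℝ) (u : ℝ → ℂ) : Prop :=
  u ∈ outgoingAtTop α θ ∧ Tendsto (fun x => u x / wkbRight α θ x) atTop (𝓝 1)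

/-- `u` is the normalized outgoing (reflected) wave `u^<_{-∞}`. -/
def IsNormalizedOutgoingAtBot (α θ : ℝ) (u : ℝ → ℂ) : Prop :=
  u ∈ outgoingAtBot α θ ∧ Tendsto (fun x => u x / wkbLeft α θ x) atBot (𝓝 1)

/-- `u` is the normalized incoming (incident) wave `u^>_{-∞}`. -/
def IsNormalizedIncomingAtBot (α θ : ℝ) (u : ℝ → ℂ) : Prop :=
  u ∈ incomingAtBot α θ ∧ Tendsto (fun x => u x / wkbRight α θ x) atBot (𝓝 1)

/-- `R` is the reflection coefficient: `u^>_{+∞} = A u^<_{-∞} + B u^>_{-∞}` with `B ≠ 0`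
and `R = A / B`. -/
def IsReflectionCoefficient (α θ : ℝ) (R : ℂ) : Prop :=
  ∃ (ut ur ui : ℝ → ℂ) (A B : ℂ),
    IsNormalizedOutgoingAtTop α θ ut ∧ IsNormalizedOutgoingAtBot α θ ur ∧
    IsNormalizedIncomingAtBot α θ ui ∧
    ut = A • ur + B • ui ∧ B ≠ 0 ∧ R = A / B

/-! ### Airy functions -/

/-- The Airy function `Ai`, as an entire function: the inverse Fourier integral
`(2π)⁻¹ ∫ e^{i(s³/3 + z s)} ds` of `e^{is³/3}`, taken along the horizontal line `s = t + i`,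
`t ∈ ℝ`, where it converges absolutely for every complex `z`. -/
def airyAi (z : ℂ) : ℂ :=
  (1 / (2 * (Real.pi : ℂ))) * ∫ t : ℝ,
    Complex.exp (Complex.I *
      (((t : ℂ) + Complex.I) ^ 3 / 3 + z * ((t : ℂ) + Complex.I)))

/-- `w₊(X) = Ai(e^{iπ/3} X)`. -/
def wPlus (X : ℂ) : ℂ := airyAi (Complex.exp (Complex.I * (Real.pi : ℂ) / 3) * X)

/-- `w₋(X) = Ai(e^{-iπ/3} X)`. -/
def wMinus (X : ℂ) : ℂ := airyAi (Complex.exp (-(Complex.I * (Real.pi : ℂ) / 3)) * X)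

/-- `β = θ^{-2/3}`. -/
def beta (θ : ℝ) : ℝ := θ ^ (-(2 / 3) : ℝ)

/-- `u` is the solution on `ℝ` of the ramp equation `u'' + (1 + θ x₊) u = 0` that is given on
`x ≥ 0` by `x ↦ w(β(1 + θx))`. -/
def IsRampSolutionOf (θ : ℝ) (w : ℂ → ℂ) (u : ℝ → ℂ) : Prop :=
  IsSolution 1 θ 0 u ∧
    ∀ x : ℝ, 0 ≤ x → u x = w ((beta θ : ℂ) * (1 + (θ : ℂ) * (x : ℂ)))

end RampReflection

end

/-!
On `x ≥ 0` the substitution `X = k^{2/3} β (1 + θx)`, `k = 1 + iσ`, turns the extended equation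
into `w'' = -X w`, which `w₊` and `w₋` solve; on `x ≤ 0` its solutions are combinations of
`e^{±ikx}`. Hence the Cauchy problem at `x = 0` has an explicit solution, jointly continuous in `σ`
and `x` (`cauchySol`), and every solution is of this form because Wronskians are constant
(`IsSolution.eq_add`). That `w₊` and `w₋` are independent amounts to `Ai(0) Ai'(0) ≠ 0`, which
follows from the convexity of `|Ai|²` on `[0, ∞)` (`airyAi_zero_mul_deriv_ne_zero`).

*The Airy function.* The defining integral may be taken along the line `t ↦ t + ip` for every
complex `p` with `Re p > 0` (`airyMoment_zero_eq`). Through the saddle point, `p² = z`, it becomes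
`Ai(p²) = e^{-2p³/3} (2π)⁻¹ ∫ e^{-p t² + i t³/3} dt` (`airyAi_sq`), and rescaling `t` gives the
leading asymptotics along each ray in `|arg z| < π` by dominated convergence
(`exists_tendsto_airyAi`). This yields the decay at `+∞` of the `w₊`-wave for `σ < 0` and of the
`w₋`-wave for `σ > 0`, and, at `σ = 0`, the agreement of `w₊(β(1 + θx))` with a multiple of the WKB
function `v^>`.

*Limiting absorption.* With `m² = -k²` and `Re m > 0`, the quantity `G = Re (conj (m u) u')`
satisfies `G' ≥ 2 Re(m) G`, so it is nonpositive at `x = 0` when `u` decays at `+∞`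
(`IsSolution.inner_nonpos`). Thus not all solutions decay, any two decaying ones are proportional,
and proportionality passes to the limit `σ → 0`: each space of polarized waves is spanned by the
limit of one explicit family (`polarizedSpace_eq_span`).

*Reflection.* As the spaces are lines, the normalized waves are unique, and the decomposition of
the transmitted wave is a pair of linear equations for `A` and `B` at `x = 0`. The coefficient `B`
does not vanish: in the limit `σ → 0⁻` the inequality for `G` says that the wave outgoing to `+∞`
carries flux of one sign, whereas a multiple of `e^{ix}` on `x ≤ 0` has flux of the other sign
(`neg_deriv_wPlus_add_ne_zero`).
-/

namespace RampReflection

section Airy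

open MeasureTheory Complex

/-! ### The Airy integral -/

/-- The Airy integrand `e^{i(s³/3 + z s)}` at the point `s = t + ip`. For complex `p` with positive
real part the path `t ↦ t + ip` is a horizontal line that the integral still converges along. -/
noncomputable def airyKernel (z p : ℂ) (t : ℝ) : ℂ :=
  exp (I * (((t : ℂ) + I * p) ^ 3 / 3 + z * ((t : ℂ) + I * p)))

/-- The `n`-th moment `∫ sⁿ e^{i(s³/3 + z s)} ds` over the line `s = t + ip`. -/
noncomputable def airyMoment (n : ℕ) (z p : ℂ) : ℂ :=
  ∫ t : ℝ, ((t : ℂ) + I * p) ^ n * airyKernel z p t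

/-- Expanding the cube leaves `-p t²` as the leading real part of the exponent. -/
lemma airyKernel_eq (z p : ℂ) (t : ℝ) :
    airyKernel z p t =
      exp (((t ^ 3 / 3 : ℝ) : ℂ) * I - p * (t : ℂ) ^ 2 + I * (z - p ^ 2) * t
        + (p ^ 3 / 3 - z * p)) := by
  unfold airyKernel
  congr 1
  push_cast
  linear_combination
    (p * (t : ℂ) ^ 2 + I * t * p ^ 2 + (I ^ 2 - 1) * p ^ 3 / 3 + z * p) * I_sq

/-- Gaussian domination of all moments, locally uniformly in `z` and `p`. -/
lemma exists_norm_airyKernel_le (n : ℕ) (R : ℝ) {c : ℝ} (hc : 0 < c) :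
    ∃ C : ℝ, ∀ (z p : ℂ) (t : ℝ), ‖z‖ ≤ R → ‖p‖ ≤ R → c ≤ p.re →
      ‖((t : ℂ) + I * p) ^ n * airyKernel z p t‖ ≤ C * Real.exp (-(c / 2) * t ^ 2) := by
  set B : ℝ := R + R ^ 2 + 1 with hB
  refine ⟨n.factorial * Real.exp (R + R ^ 3 + R ^ 2 + B ^ 2 / (2 * c)), fun z p t hz hp hpc => ?_⟩
  have hR : 0 ≤ R := (norm_nonneg z).trans hz
  have h1 : ‖((t : ℂ) + I * p) ^ n‖ ≤ n.factorial * Real.exp (|t| + R) := by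
    have h2 : ‖(t : ℂ) + I * p‖ ≤ |t| + R := by
      refine (norm_add_le _ _).trans ?_
      rw [norm_mul, norm_I, one_mul, norm_real, Real.norm_eq_abs]
      gcongr
    rw [norm_pow]
    refine (pow_le_pow_left₀ (norm_nonneg _) h2 n).trans ?_
    have := Real.pow_div_factorial_le_exp (|t| + R) (by positivity) n
    rwa [div_le_iff₀ (by positivity), mul_comm] at this
  have h3 : ‖airyKernel z p t‖ ≤ Real.exp (-c * t ^ 2 + (R + R ^ 2) * |t| + (R ^ 3 + R ^ 2)) := by
    rw [airyKernel_eq, norm_exp]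
    refine Real.exp_le_exp.2 ?_
    have e1 : (((t ^ 3 / 3 : ℝ) : ℂ) * I).re = 0 := by
      rw [re_ofReal_mul, I_re, mul_zero]
    have e2 : (p * (t : ℂ) ^ 2).re = p.re * t ^ 2 := by
      rw [← ofReal_pow, re_mul_ofReal]
    have e3 : (I * (z - p ^ 2) * t).re ≤ (R + R ^ 2) * |t| := by
      refine (re_le_norm _).trans ?_
      rw [norm_mul, norm_mul, norm_I, one_mul, norm_real, Real.norm_eq_abs]
      gcongr
      refine (norm_sub_le _ _).trans ?_
      rw [norm_pow]
      gcongr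
    have e4 : (p ^ 3 / 3 - z * p).re ≤ R ^ 3 + R ^ 2 := by
      refine (re_le_norm _).trans ((norm_sub_le _ _).trans ?_)
      rw [norm_div, norm_pow, norm_mul]
      have : ‖p‖ ^ 3 ≤ R ^ 3 := by gcongr
      have h3 : ‖(3 : ℂ)‖ = 3 := by simp
      have : ‖z‖ * ‖p‖ ≤ R * R := by gcongr
      have : 0 ≤ ‖p‖ ^ 3 := by positivity
      rw [h3]
      nlinarith
    rw [add_re, add_re, sub_re, e1, e2]
    have := mul_le_mul_of_nonneg_right hpc (sq_nonneg t)
    linarith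
  rw [norm_mul]
  refine (mul_le_mul h1 h3 (norm_nonneg _) (by positivity)).trans ?_
  rw [mul_assoc, mul_assoc, ← Real.exp_add, ← Real.exp_add]
  refine mul_le_mul_of_nonneg_left (Real.exp_le_exp.2 ?_) (by positivity)
  -- the linear term `B |t|` is absorbed in half of the Gaussian exponent
  have h5 : B * |t| ≤ c / 2 * t ^ 2 + B ^ 2 / (2 * c) := by
    have : 0 ≤ (c * |t| - B) ^ 2 / (2 * c) := by positivity
    have h6 : (c * |t| - B) ^ 2 / (2 * c) = c / 2 * |t| ^ 2 + B ^ 2 / (2 * c) - B * |t| := by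
      field_simp
      ring
    rw [h6, sq_abs] at this
    linarith
  rw [hB] at h5 ⊢
  nlinarith

lemma continuous_airyKernel (z p : ℂ) : Continuous (airyKernel z p) := by
  unfold airyKernel
  fun_prop

lemma continuous_airyIntegrand (n : ℕ) (z p : ℂ) :
    Continuous fun t : ℝ => ((t : ℂ) + I * p) ^ n * airyKernel z p t := by
  have := continuous_airyKernel z p
  fun_prop

lemma integrable_airyIntegrand (n : ℕ) (z : ℂ) {p : ℂ} (hp : 0 < p.re) :
    Integrable fun t : ℝ => ((t : ℂ) + I * p) ^ n * airyKernel z p t := by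
  obtain ⟨C, hC⟩ := exists_norm_airyKernel_le n (max ‖z‖ ‖p‖) hp
  refine ((integrable_exp_neg_mul_sq (half_pos hp)).const_mul C).mono'
    (continuous_airyIntegrand n z p).aestronglyMeasurable (Eventually.of_forall fun t => ?_)
  exact hC z p t (le_max_left _ _) (le_max_right _ _) le_rfl

lemma hasDerivAt_airyMoment (n : ℕ) (z : ℂ) {p : ℂ} (hp : 0 < p.re) :
    HasDerivAt (fun z => airyMoment n z p) (I * airyMoment (n + 1) z p) z := by
  obtain ⟨C, hC⟩ := exists_norm_airyKernel_le (n + 1) (max (‖z‖ + 1) ‖p‖) hp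
  have key := (hasDerivAt_integral_of_dominated_loc_of_deriv_le (μ := volume) (x₀ := z)
    (F := fun z (t : ℝ) => ((t : ℂ) + I * p) ^ n * airyKernel z p t)
    (F' := fun z (t : ℝ) => I * (((t : ℂ) + I * p) ^ (n + 1) * airyKernel z p t))
    (bound := fun t => C * Real.exp (-(p.re / 2) * t ^ 2)) (Metric.ball_mem_nhds z one_pos)
    (Eventually.of_forall fun w => (continuous_airyIntegrand n w p).aestronglyMeasurable)
    (integrable_airyIntegrand n z hp)
    ((continuous_airyIntegrand (n + 1) z p).const_smul I).aestronglyMeasurable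
    (Eventually.of_forall fun t w hw => ?_)
    ((integrable_exp_neg_mul_sq (half_pos hp)).const_mul C)
    (Eventually.of_forall fun t w _ => ?_)).2
  · rwa [integral_const_mul] at key
  · rw [norm_mul, norm_I, one_mul]
    refine hC w p t (le_trans ?_ (le_max_left _ _)) (le_max_right _ _) le_rfl
    have := norm_sub_norm_le w z
    rw [Metric.mem_ball, dist_eq] at hw
    linarith
  · unfold airyKernel
    have h := ((((hasDerivAt_id w).mul_const ((t : ℂ) + I * p)).const_add
      (((t : ℂ) + I * p) ^ 3 / 3)).const_mul I).cexp.const_mul (((t : ℂ) + I * p) ^ n)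
    refine h.congr_deriv ?_
    simp only [id]
    ring

/-- The integrand is the derivative of the kernel along the line, so its integral vanishes. -/
lemma airyMoment_two_add (z : ℂ) {p : ℂ} (hp : 0 < p.re) :
    airyMoment 2 z p + z * airyMoment 0 z p = 0 := by
  have hint : Integrable fun t : ℝ =>
      ((t : ℂ) + I * p) ^ 2 * airyKernel z p t + z * (((t : ℂ) + I * p) ^ 0 * airyKernel z p t) :=
    (integrable_airyIntegrand 2 z hp).add ((integrable_airyIntegrand 0 z hp).const_mul z)
  have h := integral_eq_zero_of_hasDerivAt_of_integrable (f := airyKernel z p)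
    (f' := fun t : ℝ => I * (((t : ℂ) + I * p) ^ 2 * airyKernel z p t
      + z * (((t : ℂ) + I * p) ^ 0 * airyKernel z p t))) (fun t => ?_) (hint.const_mul I)
    (by simpa using integrable_airyIntegrand 0 z hp)
  · rw [integral_const_mul, mul_eq_zero, or_iff_right I_ne_zero,
      integral_add (integrable_airyIntegrand 2 z hp)
        ((integrable_airyIntegrand 0 z hp).const_mul z), integral_const_mul] at h
    exact h
  · unfold airyKernel
    have h1 : HasDerivAt (fun t : ℝ => (t : ℂ) + I * p) 1 t :=
      (ofRealCLM.hasDerivAt (x := t)).add_const (I * p)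
    have h2 := ((((h1.pow 3).div_const 3).add (h1.const_mul z)).const_mul I).cexp
    refine h2.congr_deriv ?_
    simp only [Pi.add_apply, Pi.pow_apply]
    push_cast
    ring

/-- The Airy integral does not depend on the line along which it is taken. -/
lemma airyMoment_zero_eq (z : ℂ) {p : ℂ} (hp : 0 < p.re) :
    airyMoment 0 z p = airyMoment 0 z 1 := by
  have hd : ∀ p : ℂ, 0 < p.re → HasDerivAt (fun p => airyMoment 0 z p) 0 p := by
    intro p hp
    have hp2 : 0 < p.re / 2 := half_pos hp
    obtain ⟨C, hC⟩ := exists_norm_airyKernel_le 2 (max ‖z‖ (‖p‖ + p.re / 2)) hp2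
    obtain ⟨D, hD⟩ := exists_norm_airyKernel_le 0 (max ‖z‖ (‖p‖ + p.re / 2)) hp2
    have key := (hasDerivAt_integral_of_dominated_loc_of_deriv_le (μ := volume) (x₀ := p)
      (F := fun p (t : ℝ) => ((t : ℂ) + I * p) ^ 0 * airyKernel z p t)
      (F' := fun p (t : ℝ) => -(((t : ℂ) + I * p) ^ 2 * airyKernel z p t
        + z * (((t : ℂ) + I * p) ^ 0 * airyKernel z p t)))
      (bound := fun t => C * Real.exp (-(p.re / 2 / 2) * t ^ 2)
        + ‖z‖ * (D * Real.exp (-(p.re / 2 / 2) * t ^ 2))) (Metric.ball_mem_nhds p hp2)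
      (Eventually.of_forall fun w => (continuous_airyIntegrand 0 z w).aestronglyMeasurable)
      (integrable_airyIntegrand 0 z hp)
      ((continuous_airyIntegrand 2 z p).add
        ((continuous_airyIntegrand 0 z p).const_smul z)).neg.aestronglyMeasurable
      (Eventually.of_forall fun t w hw => ?_)
      (((integrable_exp_neg_mul_sq (half_pos hp2)).const_mul C).add
        (((integrable_exp_neg_mul_sq (half_pos hp2)).const_mul D).const_mul ‖z‖))
      (Eventually.of_forall fun t w _ => ?_)).2
    · rw [integral_neg, integral_add (integrable_airyIntegrand 2 z hp)
        ((integrable_airyIntegrand 0 z hp).const_mul z), integral_const_mul] at key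
      have h0 := airyMoment_two_add z hp
      unfold airyMoment at h0
      rw [h0, neg_zero] at key
      exact key
    · rw [Metric.mem_ball, dist_eq] at hw
      have hw1 : ‖w‖ ≤ max ‖z‖ (‖p‖ + p.re / 2) := by
        refine le_trans ?_ (le_max_right _ _)
        have := norm_sub_norm_le w p
        linarith
      have hw2 : p.re / 2 ≤ w.re := by
        have := (abs_re_le_norm (w - p)).trans hw.le
        rw [sub_re] at this
        linarith [(abs_le.1 this).1]
      rw [norm_neg]
      refine (norm_add_le _ _).trans ?_
      rw [norm_mul z]
      exact add_le_add (hC z w t (le_max_left _ _) hw1 hw2)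
        (mul_le_mul_of_nonneg_left (hD z w t (le_max_left _ _) hw1 hw2) (norm_nonneg _))
    · unfold airyKernel
      have h1 : HasDerivAt (fun w : ℂ => (t : ℂ) + I * w) I w := by
        simpa using ((hasDerivAt_id w).const_mul I).const_add (t : ℂ)
      have h2 := ((((h1.pow 3).div_const 3).add (h1.const_mul z)).const_mul I).cexp
      simp only [pow_zero, one_mul]
      refine h2.congr_deriv ?_
      simp only [Pi.add_apply, Pi.pow_apply]
      push_cast
      linear_combination ((t : ℂ) + I * w) ^ 2 * exp (I * (((t : ℂ) + I * w) ^ 3 / 3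
        + z * ((t : ℂ) + I * w))) * I_sq + z * exp (I * (((t : ℂ) + I * w) ^ 3 / 3
        + z * ((t : ℂ) + I * w))) * I_sq
  have hopen : IsOpen {p : ℂ | 0 < p.re} := isOpen_lt continuous_const continuous_re
  exact hopen.is_const_of_deriv_eq_zero (convex_halfSpace_re_gt 0).isPreconnected
    (fun q hq => (hd q hq).differentiableAt.differentiableWithinAt)
    (fun q hq => (hd q hq).deriv) hp (by simp)

lemma airyAi_eq_airyMoment (z : ℂ) {p : ℂ} (hp : 0 < p.re) :
    airyAi z = 1 / (2 * (Real.pi : ℂ)) * airyMoment 0 z p := by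
  rw [airyMoment_zero_eq z hp]
  simp [airyAi, airyMoment, airyKernel]

lemma hasDerivAt_airyAi_aux (z : ℂ) :
    HasDerivAt airyAi (1 / (2 * (Real.pi : ℂ)) * (I * airyMoment 1 z 1)) z := by
  have h : airyAi = fun z => 1 / (2 * (Real.pi : ℂ)) * airyMoment 0 z 1 :=
    funext fun z => airyAi_eq_airyMoment z (by simp)
  rw [h]
  exact (hasDerivAt_airyMoment 0 z (by simp)).const_mul _

lemma hasDerivAt_airyAi (z : ℂ) : HasDerivAt airyAi (deriv airyAi z) z :=
  (hasDerivAt_airyAi_aux z).differentiableAt.hasDerivAt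

/-- Airy's equation `Ai'' = z Ai`. -/
lemma hasDerivAt_deriv_airyAi (z : ℂ) : HasDerivAt (deriv airyAi) (z * airyAi z) z := by
  have h : deriv airyAi = fun z => 1 / (2 * (Real.pi : ℂ)) * (I * airyMoment 1 z 1) :=
    funext fun z => (hasDerivAt_airyAi_aux z).deriv
  rw [h]
  refine (((hasDerivAt_airyMoment 1 z (by simp)).const_mul I).const_mul _).congr_deriv ?_
  rw [airyAi_eq_airyMoment z (p := 1) (by simp)]
  linear_combination (1 / (2 * (Real.pi : ℂ)) * airyMoment 2 z 1) * I_sq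
    - 1 / (2 * (Real.pi : ℂ)) * airyMoment_two_add z (p := 1) (by simp)

/-- On the line through the saddle point `s = ip` of the exponent at `z = p²`, the linear term
drops out and the Airy integral becomes a perturbed Gaussian. -/
lemma airyAi_sq {p : ℂ} (hp : 0 < p.re) :
    airyAi (p ^ 2) = 1 / (2 * (Real.pi : ℂ)) * (exp (-(2 / 3 * p ^ 3)) *
      ∫ t : ℝ, exp (-p * (t : ℂ) ^ 2 + ((t ^ 3 / 3 : ℝ) : ℂ) * I)) := by
  rw [airyAi_eq_airyMoment _ hp, airyMoment, ← integral_const_mul (exp _)]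
  congr 2
  funext t
  rw [pow_zero, one_mul, airyKernel_eq, ← exp_add]
  congr 1
  ring

/-- Leading asymptotics of the Airy function along the ray through `p²`: after the substitution
`t = s / q` the integral of `airyAi_sq` tends to the Gaussian integral `∫ e^{-p s²} ds`. -/
lemma exists_tendsto_airyAi {p : ℂ} (hp : 0 < p.re) :
    ∃ C : ℂ, C ≠ 0 ∧ Tendsto (fun q : ℝ => airyAi (p ^ 2 * (q : ℂ) ^ 4) *
      exp (2 / 3 * p ^ 3 * (q : ℂ) ^ 6) * q) atTop (𝓝 C) := by
  have hp0 : p ≠ 0 := by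
    rintro rfl
    simp at hp
  have hpi : (Real.pi : ℂ) ≠ 0 := ofReal_ne_zero.2 Real.pi_ne_zero
  refine ⟨1 / (2 * (Real.pi : ℂ)) * (Real.pi / p) ^ (1 / 2 : ℂ), ?_, ?_⟩
  · refine mul_ne_zero (by simp [hpi]) ?_
    rw [cpow_ne_zero_iff]
    exact Or.inl (div_ne_zero hpi hp0)
  have hlim : Tendsto (fun q : ℝ => ∫ s : ℝ,
      exp (-p * (s : ℂ) ^ 2 + ((s ^ 3 / 3 * (q⁻¹) ^ 3 : ℝ) : ℂ) * I)) atTop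
      (𝓝 (∫ s : ℝ, exp (-p * (s : ℂ) ^ 2))) := by
    refine tendsto_integral_filter_of_dominated_convergence
      (fun s => Real.exp (-p.re * s ^ 2)) ?_ ?_ (integrable_exp_neg_mul_sq hp) ?_
    · refine Eventually.of_forall fun q => Continuous.aestronglyMeasurable ?_
      fun_prop
    · refine Eventually.of_forall fun q => Eventually.of_forall fun s => le_of_eq ?_
      rw [norm_exp, add_re, re_ofReal_mul, I_re, mul_zero, add_zero, ← ofReal_pow, re_mul_ofReal,
        neg_re]
    · refine Eventually.of_forall fun s => ?_
      have h1 : Tendsto (fun q : ℝ => s ^ 3 / 3 * (q⁻¹) ^ 3) atTop (𝓝 0) := by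
        have := ((tendsto_inv_atTop_zero (𝕜 := ℝ)).pow 3).const_mul (s ^ 3 / 3)
        rwa [zero_pow three_ne_zero, mul_zero] at this
      have h2 : Tendsto (fun q : ℝ => -p * (s : ℂ) ^ 2 + ((s ^ 3 / 3 * (q⁻¹) ^ 3 : ℝ) : ℂ) * I)
          atTop (𝓝 (-p * (s : ℂ) ^ 2 + ((0 : ℝ) : ℂ) * I)) :=
        (((continuous_ofReal.tendsto 0).comp h1).mul_const I).const_add _
      rw [ofReal_zero, zero_mul, add_zero] at h2
      exact (continuous_exp.tendsto _).comp h2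
  rw [integral_gaussian_complex hp] at hlim
  refine (hlim.const_mul (1 / (2 * (Real.pi : ℂ)))).congr' ?_
  filter_upwards [eventually_gt_atTop 0] with q hq
  have hq0 : (q : ℂ) ≠ 0 := ofReal_ne_zero.2 hq.ne'
  have hre : 0 < (p * (q : ℂ) ^ 2).re := by
    rw [← ofReal_pow, re_mul_ofReal]
    positivity
  have hsub := Measure.integral_comp_mul_left (fun s : ℝ =>
    exp (-p * (s : ℂ) ^ 2 + ((s ^ 3 / 3 * (q⁻¹) ^ 3 : ℝ) : ℂ) * I)) q
  have hcongr : ∀ t : ℝ, exp (-p * ((q * t : ℝ) : ℂ) ^ 2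
      + (((q * t) ^ 3 / 3 * (q⁻¹) ^ 3 : ℝ) : ℂ) * I)
      = exp (-(p * (q : ℂ) ^ 2) * (t : ℂ) ^ 2 + ((t ^ 3 / 3 : ℝ) : ℂ) * I) := by
    intro t
    congr 1
    push_cast
    field_simp
  simp only [hcongr] at hsub
  rw [abs_of_pos (inv_pos.2 hq), real_smul, ofReal_inv] at hsub
  have h4 : p ^ 2 * (q : ℂ) ^ 4 = (p * (q : ℂ) ^ 2) ^ 2 := by ring
  rw [h4, airyAi_sq hre, hsub]
  have h5 : exp (-(2 / 3 * (p * (q : ℂ) ^ 2) ^ 3)) * exp (2 / 3 * p ^ 3 * (q : ℂ) ^ 6) = 1 := by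
    rw [← exp_add, ← exp_zero]
    congr 1
    ring
  generalize (∫ s : ℝ, exp (-p * (s : ℂ) ^ 2 + ((s ^ 3 / 3 * (q⁻¹) ^ 3 : ℝ) : ℂ) * I)) = J
  generalize exp (-(2 / 3 * (p * (q : ℂ) ^ 2) ^ 3)) = a at *
  generalize exp (2 / 3 * p ^ 3 * (q : ℂ) ^ 6) = b at *
  field_simp
  linear_combination (-J) * h5

lemma tendsto_rpow_quarter_atTop : Tendsto (fun x : ℝ => x ^ (1 / 4 : ℝ)) atTop atTop :=
  tendsto_rpow_atTop (by norm_num)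

/-- `Ai` decays along the rays on which `Re z^{3/2} ≥ 0`. -/
lemma tendsto_airyAi_zero {p : ℂ} (hp : 0 < p.re) (hp3 : 0 ≤ (p ^ 3).re) :
    Tendsto (fun x : ℝ => airyAi (p ^ 2 * x)) atTop (𝓝 0) := by
  obtain ⟨C, -, hC⟩ := exists_tendsto_airyAi hp
  have h1 : Tendsto (fun q : ℝ => airyAi (p ^ 2 * (q : ℂ) ^ 4)) atTop (𝓝 0) := by
    have h2 : Tendsto (fun q : ℝ => ‖airyAi (p ^ 2 * (q : ℂ) ^ 4) *
      exp (2 / 3 * p ^ 3 * (q : ℂ) ^ 6) * q‖ * q⁻¹) atTop (𝓝 0) := by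
      simpa using hC.norm.mul tendsto_inv_atTop_zero
    refine squeeze_zero_norm' ?_ h2
    filter_upwards [eventually_gt_atTop 0] with q hq
    rw [norm_mul, norm_mul, norm_real, Real.norm_eq_abs, abs_of_pos hq, mul_assoc,
      mul_inv_cancel₀ hq.ne', mul_one]
    refine le_mul_of_one_le_right (norm_nonneg _) ?_
    rw [norm_exp, Real.one_le_exp_iff]
    have : (2 / 3 * p ^ 3 * (q : ℂ) ^ 6).re = 2 / 3 * (p ^ 3).re * q ^ 6 := by
      rw [← ofReal_pow, re_mul_ofReal]
      congr 1
      simp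
    rw [this]
    positivity
  refine (h1.comp tendsto_rpow_quarter_atTop).congr' ?_
  filter_upwards [eventually_ge_atTop 0] with x hx
  rw [Function.comp_apply, ← ofReal_pow, ← Real.rpow_natCast, ← Real.rpow_mul hx]
  norm_num

/-- `Ai(0)` and `Ai'(0)` do not vanish: on `[0, ∞)` the function `|Ai|²` is convex, so a critical
point or a zero at `0` would make it nondecreasing, against its decay at infinity. -/
lemma airyAi_zero_mul_deriv_ne_zero : airyAi 0 * deriv airyAi 0 ≠ 0 := by
  intro h0
  have hf : ∀ x : ℝ, HasDerivAt (fun x : ℝ => airyAi x) (deriv airyAi x) x := fun x =>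
    (hasDerivAt_airyAi x).comp_ofReal
  have hf' : ∀ x : ℝ, HasDerivAt (fun x : ℝ => deriv airyAi x) (x * airyAi x) x := fun x =>
    (hasDerivAt_deriv_airyAi x).comp_ofReal
  have hinner : ∀ x : ℝ, HasDerivAt (fun x : ℝ => inner ℝ (airyAi x) (deriv airyAi x))
      (x * ‖airyAi x‖ ^ 2 + ‖deriv airyAi x‖ ^ 2) x := by
    intro x
    refine ((hf x).inner ℝ (hf' x)).congr_deriv ?_
    rw [← real_inner_self_eq_norm_sq, ← real_inner_self_eq_norm_sq, ← real_smul,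
      real_inner_smul_right]
  have hmono : MonotoneOn (fun x : ℝ => inner ℝ (airyAi x) (deriv airyAi x)) (Set.Ici 0) := by
    refine monotoneOn_of_hasDerivWithinAt_nonneg (convex_Ici 0)
      (fun x _ => (hinner x).continuousAt.continuousWithinAt)
      (fun x _ => (hinner x).hasDerivWithinAt) fun x hx => ?_
    rw [interior_Ici] at hx
    have : 0 < x := hx
    positivity
  have h00 : inner ℝ (airyAi (0 : ℝ)) (deriv airyAi (0 : ℝ)) = 0 := by
    rcases mul_eq_zero.1 h0 with h | h <;> simp [h]
  have hsq : MonotoneOn (fun x : ℝ => ‖airyAi x‖ ^ 2) (Set.Ici 0) := by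
    refine monotoneOn_of_hasDerivWithinAt_nonneg (convex_Ici 0)
      (fun x _ => (hf x).norm_sq.continuousAt.continuousWithinAt)
      (fun x _ => (hf x).norm_sq.hasDerivWithinAt) fun x hx => ?_
    rw [interior_Ici] at hx
    have hx0 : 0 ≤ x := le_of_lt hx
    have h1 := hmono Set.self_mem_Ici hx0 hx0
    simp only [h00] at h1
    linarith
  have hdecay : Tendsto (fun x : ℝ => ‖airyAi x‖ ^ 2) atTop (𝓝 0) := by
    simpa using ((tendsto_airyAi_zero (p := 1) (by simp) (by simp)).norm.pow 2)
  have hzero : ∀ x : ℝ, 0 ≤ x → airyAi x = 0 := by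
    intro x hx
    have : ‖airyAi x‖ ^ 2 ≤ 0 := by
      refine ge_of_tendsto hdecay ?_
      filter_upwards [eventually_ge_atTop x] with y hy
      exact hsq hx (hx.trans hy) hy
    simpa using this
  obtain ⟨C, hC0, hC⟩ := exists_tendsto_airyAi (p := 1) (by simp)
  refine hC0 (tendsto_nhds_unique hC (tendsto_const_nhds.congr fun q => ?_))
  have := hzero (q ^ 4) (by positivity)
  push_cast at this
  simp [this]

end Airy

section Cauchy

open Complex

/-! ### The rotated Airy equation -/

/-- `w` is an entire solution of the rotated Airy equation `w'' = -X w`. -/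
def IsRotatedAiry (w : ℂ → ℂ) : Prop :=
  ∀ X : ℂ, HasDerivAt w (deriv w X) X ∧ HasDerivAt (deriv w) (-(X * w X)) X

lemma IsRotatedAiry.continuous {w : ℂ → ℂ} (hw : IsRotatedAiry w) : Continuous w :=
  continuous_iff_continuousAt.2 fun X => (hw X).1.continuousAt

lemma IsRotatedAiry.continuous_deriv {w : ℂ → ℂ} (hw : IsRotatedAiry w) : Continuous (deriv w) :=
  continuous_iff_continuousAt.2 fun X => (hw X).2.continuousAt

lemma hasDerivAt_airyAi_rotate (η X : ℂ) :
    HasDerivAt (fun X => airyAi (η ^ 2 * X)) (η ^ 2 * deriv airyAi (η ^ 2 * X)) X := by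
  have := (hasDerivAt_airyAi (η ^ 2 * X)).comp X ((hasDerivAt_id X).const_mul (η ^ 2))
  exact this.congr_deriv (by ring)

lemma isRotatedAiry_airyAi_rotate {η : ℂ} (hη : η ^ 6 = -1) :
    IsRotatedAiry fun X => airyAi (η ^ 2 * X) := by
  intro X
  have hd : deriv (fun X => airyAi (η ^ 2 * X)) = fun X => η ^ 2 * deriv airyAi (η ^ 2 * X) :=
    funext fun X => (hasDerivAt_airyAi_rotate η X).deriv
  refine ⟨(hasDerivAt_airyAi_rotate η X).differentiableAt.hasDerivAt, ?_⟩
  rw [hd]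
  have := ((hasDerivAt_deriv_airyAi (η ^ 2 * X)).comp X
    ((hasDerivAt_id X).const_mul (η ^ 2))).const_mul (η ^ 2)
  refine this.congr_deriv ?_
  linear_combination X * airyAi (η ^ 2 * X) * hη

/-- The square root `e^{iπ/6}` of the rotation in `w₊`; the saddle-point variable of `w₊(X)` is
`e^{iπ/6} X^{1/2}`. -/
noncomputable def rotPlus : ℂ := exp (((Real.pi / 6 : ℝ) : ℂ) * I)

/-- The square root `e^{-iπ/6}` of the rotation in `w₋`. -/
noncomputable def rotMinus : ℂ := exp (((-(Real.pi / 6) : ℝ) : ℂ) * I)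

lemma rotPlus_pow_three : rotPlus ^ 3 = I := by
  refine Eq.trans ?_ exp_pi_div_two_mul_I
  rw [rotPlus, ← exp_nat_mul]
  congr 1
  push_cast
  ring

lemma rotMinus_pow_three : rotMinus ^ 3 = -I := by
  refine Eq.trans ?_ exp_neg_pi_div_two_mul_I
  rw [rotMinus, ← exp_nat_mul]
  congr 1
  push_cast
  ring

lemma rotPlus_pow_six : rotPlus ^ 6 = -1 := by
  rw [show 6 = 3 * 2 from rfl, pow_mul, rotPlus_pow_three, I_sq]

lemma rotMinus_pow_six : rotMinus ^ 6 = -1 := by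
  rw [show 6 = 3 * 2 from rfl, pow_mul, rotMinus_pow_three, neg_sq, I_sq]

lemma wPlus_eq : wPlus = fun X => airyAi (rotPlus ^ 2 * X) := by
  funext X
  rw [wPlus, rotPlus, ← exp_nat_mul]
  congr 3
  push_cast
  ring

lemma wMinus_eq : wMinus = fun X => airyAi (rotMinus ^ 2 * X) := by
  funext X
  rw [wMinus, rotMinus, ← exp_nat_mul]
  congr 3
  push_cast
  ring

lemma isRotatedAiry_wPlus : IsRotatedAiry wPlus :=
  wPlus_eq ▸ isRotatedAiry_airyAi_rotate rotPlus_pow_six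

lemma isRotatedAiry_wMinus : IsRotatedAiry wMinus :=
  wMinus_eq ▸ isRotatedAiry_airyAi_rotate rotMinus_pow_six

lemma IsRotatedAiry.wronskian_eq {v w : ℂ → ℂ} (hv : IsRotatedAiry v) (hw : IsRotatedAiry w)
    (X Y : ℂ) :
    v X * deriv w X - deriv v X * w X = v Y * deriv w Y - deriv v Y * w Y := by
  have h : ∀ X, HasDerivAt (fun X => v X * deriv w X - deriv v X * w X) 0 X := fun X =>
    (((hv X).1.mul (hw X).2).sub ((hv X).2.mul (hw X).1)).congr_deriv (by ring)
  exact is_const_of_deriv_eq_zero (fun X => (h X).differentiableAt) (fun X => (h X).deriv) X Y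

/-- The Wronskian of the basis `w₊`, `w₋` of solutions of the rotated Airy equation. -/
noncomputable def airyWronskian : ℂ := wPlus 0 * deriv wMinus 0 - deriv wPlus 0 * wMinus 0

lemma airyWronskian_ne_zero : airyWronskian ≠ 0 := by
  have h1 : rotMinus ^ 2 - rotPlus ^ 2 ≠ 0 := by
    intro h
    have hp : rotPlus ^ 2 = exp (((Real.pi / 3 : ℝ) : ℂ) * I) := by
      rw [rotPlus, ← exp_nat_mul]
      congr 1
      push_cast
      ring
    have hm : rotMinus ^ 2 = exp (((-(Real.pi / 3) : ℝ) : ℂ) * I) := by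
      rw [rotMinus, ← exp_nat_mul]
      congr 1
      push_cast
      ring
    have h3 := congrArg im h
    rw [hp, hm, sub_im, exp_ofReal_mul_I_im, exp_ofReal_mul_I_im, Real.sin_neg,
      Real.sin_pi_div_three, zero_im] at h3
    have : 0 < √3 / 2 := by positivity
    linarith
  have h2 : airyWronskian = (rotMinus ^ 2 - rotPlus ^ 2) * (airyAi 0 * deriv airyAi 0) := by
    rw [airyWronskian, wPlus_eq, wMinus_eq, (hasDerivAt_airyAi_rotate _ _).deriv,
      (hasDerivAt_airyAi_rotate _ _).deriv]
    simp only [mul_zero]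
    ring
  rw [h2]
  exact mul_ne_zero h1 airyAi_zero_mul_deriv_ne_zero

/-- The solution of the rotated Airy equation with value `a` and derivative `b` at `X₀`. -/
noncomputable def airyCauchy (X₀ a b X : ℂ) : ℂ :=
  ((a * deriv wMinus X₀ - b * wMinus X₀) * wPlus X
    + (b * wPlus X₀ - a * deriv wPlus X₀) * wMinus X) / airyWronskian

/-- The derivative of `airyCauchy`. -/
noncomputable def airyCauchyDeriv (X₀ a b X : ℂ) : ℂ :=
  ((a * deriv wMinus X₀ - b * wMinus X₀) * deriv wPlus X
    + (b * wPlus X₀ - a * deriv wPlus X₀) * deriv wMinus X) / airyWronskian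

lemma hasDerivAt_airyCauchy (X₀ a b X : ℂ) :
    HasDerivAt (airyCauchy X₀ a b) (airyCauchyDeriv X₀ a b X) X :=
  (((isRotatedAiry_wPlus X).1.const_mul _).add
    ((isRotatedAiry_wMinus X).1.const_mul _)).div_const _

lemma hasDerivAt_airyCauchyDeriv (X₀ a b X : ℂ) :
    HasDerivAt (airyCauchyDeriv X₀ a b) (-(X * airyCauchy X₀ a b X)) X := by
  refine ((((isRotatedAiry_wPlus X).2.const_mul _).add
    ((isRotatedAiry_wMinus X).2.const_mul _)).div_const _).congr_deriv ?_
  rw [airyCauchy]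
  ring

/-- The Plücker identity among the Wronskians of `w`, `w₊`, `w₋` expresses `w` in the basis. -/
lemma IsRotatedAiry.airyCauchy_eq {w : ℂ → ℂ} (hw : IsRotatedAiry w) (X₀ X : ℂ) :
    airyCauchy X₀ (w X₀) (deriv w X₀) X = w X := by
  rw [airyCauchy, div_eq_iff airyWronskian_ne_zero]
  have h1 := hw.wronskian_eq isRotatedAiry_wMinus X₀ X
  have h2 := hw.wronskian_eq isRotatedAiry_wPlus X₀ X
  have h3 : airyWronskian = _ := isRotatedAiry_wPlus.wronskian_eq isRotatedAiry_wMinus 0 X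
  linear_combination wPlus X * h1 - wMinus X * h2 - w X * h3

lemma airyCauchy_self (X₀ a b : ℂ) : airyCauchy X₀ a b X₀ = a := by
  have h3 : airyWronskian = _ := isRotatedAiry_wPlus.wronskian_eq isRotatedAiry_wMinus 0 X₀
  rw [airyCauchy, div_eq_iff airyWronskian_ne_zero, h3]
  ring

lemma airyCauchyDeriv_self (X₀ a b : ℂ) : airyCauchyDeriv X₀ a b X₀ = b := by
  have h3 : airyWronskian = _ := isRotatedAiry_wPlus.wronskian_eq isRotatedAiry_wMinus 0 X₀
  rw [airyCauchyDeriv, div_eq_iff airyWronskian_ne_zero, h3]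
  ring

/-! ### The Cauchy problem for the extended ramp equation -/

/-- The complex wave number `k = 1 + iσ`. -/
noncomputable def waveNumber (σ : ℝ) : ℂ := 1 + I * (σ : ℂ)

/-- The principal cube root of `1 + iσ`. -/
noncomputable def waveNumberCbrt (σ : ℝ) : ℂ := exp (log (waveNumber σ) / 3)

lemma waveNumber_re (σ : ℝ) : (waveNumber σ).re = 1 := by simp [waveNumber]

lemma waveNumber_ne_zero (σ : ℝ) : waveNumber σ ≠ 0 := fun h => by
  simpa [h] using waveNumber_re σ

lemma waveNumber_zero : waveNumber 0 = 1 := by simp [waveNumber]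

lemma waveNumberCbrt_zero : waveNumberCbrt 0 = 1 := by simp [waveNumberCbrt, waveNumber_zero]

lemma waveNumberCbrt_pow_three (σ : ℝ) : waveNumberCbrt σ ^ 3 = waveNumber σ := by
  rw [waveNumberCbrt, ← exp_nat_mul]
  push_cast
  rw [mul_div_cancel₀ _ three_ne_zero, exp_log (waveNumber_ne_zero σ)]

lemma waveNumberCbrt_ne_zero (σ : ℝ) : waveNumberCbrt σ ≠ 0 := exp_ne_zero _

lemma continuous_waveNumber : Continuous waveNumber := by
  unfold waveNumber
  fun_prop

lemma continuous_waveNumberCbrt : Continuous waveNumberCbrt :=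
  continuous_exp.comp ((continuous_waveNumber.clog fun σ =>
    Or.inl (by simp [waveNumber_re])).div_const 3)

lemma beta_pos {θ : ℝ} (hθ : 0 < θ) : 0 < beta θ := Real.rpow_pos_of_pos hθ _

lemma beta_pow_three {θ : ℝ} (hθ : 0 < θ) : beta θ ^ 3 * θ ^ 2 = 1 := by
  rw [beta, ← Real.rpow_natCast, ← Real.rpow_mul hθ.le, ← Real.rpow_natCast, ← Real.rpow_add hθ]
  norm_num

/-- The variable `X = k^{2/3} β (1 + θx)` which turns the extended equation on `x ≥ 0` into
`w'' = -X w`. -/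
noncomputable def rampVar (θ σ x : ℝ) : ℂ :=
  waveNumberCbrt σ ^ 2 * ((beta θ : ℂ) * (1 + (θ : ℂ) * (x : ℂ)))

/-- The derivative `dX/dx` of `rampVar`. -/
noncomputable def rampVarDeriv (θ σ : ℝ) : ℂ := waveNumberCbrt σ ^ 2 * ((beta θ : ℂ) * (θ : ℂ))

lemma hasDerivAt_rampVar (θ σ x : ℝ) : HasDerivAt (rampVar θ σ) (rampVarDeriv θ σ) x := by
  have h : HasDerivAt (fun x : ℝ => (x : ℂ)) 1 x := ofRealCLM.hasDerivAt
  refine ((((h.const_mul (θ : ℂ)).const_add 1).const_mul (beta θ : ℂ)).const_mul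
    (waveNumberCbrt σ ^ 2)).congr_deriv ?_
  rw [rampVarDeriv]
  ring

lemma rampVarDeriv_ne_zero {θ : ℝ} (hθ : 0 < θ) (σ : ℝ) : rampVarDeriv θ σ ≠ 0 :=
  mul_ne_zero (pow_ne_zero _ (waveNumberCbrt_ne_zero σ))
    (mul_ne_zero (ofReal_ne_zero.2 (beta_pos hθ).ne') (ofReal_ne_zero.2 hθ.ne'))

lemma rampVarDeriv_sq_mul {θ : ℝ} (hθ : 0 < θ) (σ x : ℝ) :
    rampVarDeriv θ σ ^ 2 * rampVar θ σ x = waveNumber σ ^ 2 * (1 + (θ : ℂ) * x) := by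
  have h : ((beta θ : ℂ)) ^ 3 * (θ : ℂ) ^ 2 = 1 := by exact_mod_cast beta_pow_three hθ
  rw [rampVarDeriv, rampVar, ← waveNumberCbrt_pow_three]
  linear_combination (waveNumberCbrt σ ^ 6 * (1 + (θ : ℂ) * x)) * h

lemma continuous_rampVar (θ : ℝ) : Continuous fun q : ℝ × ℝ => rampVar θ q.1 q.2 := by
  have := continuous_waveNumberCbrt
  unfold rampVar
  fun_prop

lemma continuous_rampVarDeriv (θ : ℝ) : Continuous (rampVarDeriv θ) := by
  have := continuous_waveNumberCbrt
  unfold rampVarDeriv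
  fun_prop

/-- Two differentiable functions which agree to first order at `0` glue to a differentiable
function. -/
lemma hasDerivAt_glue {f g f' g' : ℝ → ℂ} (hf : ∀ x, HasDerivAt f (f' x) x)
    (hg : ∀ x, HasDerivAt g (g' x) x) (h0 : f 0 = g 0) (h0' : f' 0 = g' 0) (x : ℝ) :
    HasDerivAt (fun x => if x ≤ 0 then f x else g x) (if x ≤ 0 then f' x else g' x) x := by
  rcases lt_trichotomy x 0 with hx | rfl | hx
  · rw [if_pos hx.le]
    refine (hf x).congr_of_eventuallyEq ?_
    filter_upwards [Iio_mem_nhds hx] with y hy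
    exact if_pos (le_of_lt hy)
  · rw [if_pos le_rfl, ← hasDerivWithinAt_univ, ← Set.Iic_union_Ici (a := (0 : ℝ))]
    refine HasDerivWithinAt.union ?_ ?_
    · exact (hf 0).hasDerivWithinAt.congr (fun y hy => if_pos hy) (if_pos le_rfl)
    · rw [h0']
      refine (hg 0).hasDerivWithinAt.congr (fun y hy => ?_) ((if_pos le_rfl).trans h0)
      rcases (Set.mem_Ici.1 hy).eq_or_lt with rfl | h
      · exact (if_pos le_rfl).trans h0
      · exact if_neg (not_le.2 h)
  · rw [if_neg (not_le.2 hx)]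
    refine (hg x).congr_of_eventuallyEq ?_
    filter_upwards [Ioi_mem_nhds hx] with y hy
    exact if_neg (not_le.2 hy)

lemma hasDerivAt_cos_mul (k : ℂ) (x : ℝ) :
    HasDerivAt (fun x : ℝ => cos (k * x)) (-(k * sin (k * x))) x :=
  (((hasDerivAt_id (x : ℂ)).const_mul k).ccos.comp_ofReal).congr_deriv (by simp; ring)

lemma hasDerivAt_sin_mul (k : ℂ) (x : ℝ) :
    HasDerivAt (fun x : ℝ => sin (k * x)) (k * cos (k * x)) x :=
  (((hasDerivAt_id (x : ℂ)).const_mul k).csin.comp_ofReal).congr_deriv (by simp; ring)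

/-- The solution of the extended ramp equation with value `a` and derivative `b` at `0`:
trigonometric on `x ≤ 0`, a combination of rotated Airy functions on `x > 0`. -/
noncomputable def cauchySol (θ σ : ℝ) (a b : ℂ) (x : ℝ) : ℂ :=
  if x ≤ 0 then a * cos (waveNumber σ * x) + b * (sin (waveNumber σ * x) / waveNumber σ)
  else airyCauchy (rampVar θ σ 0) a (b / rampVarDeriv θ σ) (rampVar θ σ x)

lemma invSpeedSq_one (θ x : ℝ) : invSpeedSq 1 θ x = 1 + θ * max x 0 := by
  rw [invSpeedSq, Real.rpow_one]

lemma isSolution_of_hasDerivAt {θ σ : ℝ} {u u' : ℝ → ℂ} (hu : ∀ x, HasDerivAt u (u' x) x)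
    (hu' : ∀ x, HasDerivAt u' (-(waveNumber σ ^ 2 * (invSpeedSq 1 θ x : ℂ) * u x)) x) :
    IsSolution 1 θ σ u := by
  refine ⟨fun x => (hu x).differentiableAt, ?_⟩
  rw [funext fun x => (hu x).deriv]
  exact hu'

/-- The derivative of `cauchySol`. -/
noncomputable def cauchySolDeriv (θ σ : ℝ) (a b : ℂ) (x : ℝ) : ℂ :=
  if x ≤ 0 then -(a * waveNumber σ * sin (waveNumber σ * x)) + b * cos (waveNumber σ * x)
  else rampVarDeriv θ σ *
    airyCauchyDeriv (rampVar θ σ 0) a (b / rampVarDeriv θ σ) (rampVar θ σ x)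

lemma hasDerivAt_cauchySol {θ : ℝ} (hθ : 0 < θ) (σ : ℝ) (a b : ℂ) (x : ℝ) :
    HasDerivAt (cauchySol θ σ a b) (cauchySolDeriv θ σ a b x) x := by
  have hk := waveNumber_ne_zero σ
  refine hasDerivAt_glue
    (f := fun x : ℝ => a * cos (waveNumber σ * x) + b * (sin (waveNumber σ * x) / waveNumber σ))
    (g := fun x : ℝ => airyCauchy (rampVar θ σ 0) a (b / rampVarDeriv θ σ) (rampVar θ σ x))
    (f' := fun x : ℝ =>
      -(a * waveNumber σ * sin (waveNumber σ * x)) + b * cos (waveNumber σ * x))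
    (g' := fun x : ℝ => rampVarDeriv θ σ *
      airyCauchyDeriv (rampVar θ σ 0) a (b / rampVarDeriv θ σ) (rampVar θ σ x))
    (fun x => ?_) (fun x => ?_) ?_ ?_ x
  · refine (((hasDerivAt_cos_mul (waveNumber σ) x).const_mul a).add
      (((hasDerivAt_sin_mul (waveNumber σ) x).div_const (waveNumber σ)).const_mul b)).congr_deriv ?_
    field_simp
  · have h := (hasDerivAt_airyCauchy (rampVar θ σ 0) a (b / rampVarDeriv θ σ)
      (rampVar θ σ x)).comp x (hasDerivAt_rampVar θ σ x)
    exact h.congr_deriv (mul_comm _ _)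
  · simp [airyCauchy_self]
  · simp [airyCauchyDeriv_self, mul_div_cancel₀ b (rampVarDeriv_ne_zero hθ σ)]

lemma hasDerivAt_cauchySolDeriv {θ : ℝ} (hθ : 0 < θ) (σ : ℝ) (a b : ℂ) (x : ℝ) :
    HasDerivAt (cauchySolDeriv θ σ a b)
      (-(waveNumber σ ^ 2 * (invSpeedSq 1 θ x : ℂ) * cauchySol θ σ a b x)) x := by
  have hk := waveNumber_ne_zero σ
  have key := hasDerivAt_glue
    (f := fun x : ℝ => -(a * waveNumber σ * sin (waveNumber σ * x)) + b * cos (waveNumber σ * x))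
    (g := fun x : ℝ => rampVarDeriv θ σ *
      airyCauchyDeriv (rampVar θ σ 0) a (b / rampVarDeriv θ σ) (rampVar θ σ x))
    (f' := fun x : ℝ => -(waveNumber σ ^ 2 *
      (a * cos (waveNumber σ * x) + b * (sin (waveNumber σ * x) / waveNumber σ))))
    (g' := fun x : ℝ => -(waveNumber σ ^ 2 * (1 + (θ : ℂ) * x) *
      airyCauchy (rampVar θ σ 0) a (b / rampVarDeriv θ σ) (rampVar θ σ x)))
    (fun x => ?_) (fun x => ?_) ?_ ?_ x
  · refine key.congr_deriv ?_
    rw [invSpeedSq_one, cauchySol]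
    split_ifs with hx
    · rw [max_eq_right hx]
      push_cast
      ring
    · rw [max_eq_left (not_le.1 hx).le]
      push_cast
      ring
  · refine (((hasDerivAt_sin_mul (waveNumber σ) x).const_mul (a * waveNumber σ)).neg.add
      ((hasDerivAt_cos_mul (waveNumber σ) x).const_mul b)).congr_deriv ?_
    field_simp
    ring
  · have h := ((hasDerivAt_airyCauchyDeriv (rampVar θ σ 0) a (b / rampVarDeriv θ σ)
      (rampVar θ σ x)).comp x (hasDerivAt_rampVar θ σ x)).const_mul (rampVarDeriv θ σ)
    refine h.congr_deriv ?_
    rw [← rampVarDeriv_sq_mul hθ]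
    ring
  · simp [airyCauchyDeriv_self, mul_div_cancel₀ b (rampVarDeriv_ne_zero hθ σ)]
  · simp [airyCauchy_self]

lemma isSolution_cauchySol {θ : ℝ} (hθ : 0 < θ) (σ : ℝ) (a b : ℂ) :
    IsSolution 1 θ σ (cauchySol θ σ a b) :=
  isSolution_of_hasDerivAt (hasDerivAt_cauchySol hθ σ a b) (hasDerivAt_cauchySolDeriv hθ σ a b)

lemma cauchySol_zero (θ σ : ℝ) (a b : ℂ) : cauchySol θ σ a b 0 = a := by
  simp [cauchySol]

lemma deriv_cauchySol_zero {θ : ℝ} (hθ : 0 < θ) (σ : ℝ) (a b : ℂ) :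
    deriv (cauchySol θ σ a b) 0 = b := by
  rw [(hasDerivAt_cauchySol hθ σ a b 0).deriv]
  simp [cauchySolDeriv]

lemma continuous_cauchySol {θ : ℝ} (hθ : 0 < θ) {a b : ℝ → ℂ} (ha : Continuous a)
    (hb : Continuous b) :
    Continuous fun q : ℝ × ℝ => cauchySol θ q.1 (a q.1) (b q.1) q.2 := by
  have h1 := continuous_waveNumber
  have h2 := continuous_rampVar θ
  have h3 : Continuous fun q : ℝ × ℝ => rampVar θ q.1 0 :=
    h2.comp (continuous_fst.prodMk continuous_const)
  have h4 := continuous_rampVarDeriv θ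
  have h5 := isRotatedAiry_wPlus.continuous
  have h6 := isRotatedAiry_wPlus.continuous_deriv
  have h7 := isRotatedAiry_wMinus.continuous
  have h8 := isRotatedAiry_wMinus.continuous_deriv
  have h9 : Continuous fun q : ℝ × ℝ => b q.1 / rampVarDeriv θ q.1 :=
    (hb.comp continuous_fst).div (h4.comp continuous_fst) fun q => rampVarDeriv_ne_zero hθ q.1
  have h10 : Continuous fun q : ℝ × ℝ => sin (waveNumber q.1 * q.2) / waveNumber q.1 :=
    Continuous.div (by fun_prop) (by fun_prop) fun q => waveNumber_ne_zero q.1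
  refine Continuous.if_le ?_ ?_ continuous_snd continuous_const ?_
  · fun_prop
  · unfold airyCauchy
    refine Continuous.div_const ?_ _
    fun_prop
  · rintro ⟨σ, x⟩ (rfl : x = 0)
    simp [airyCauchy_self]

lemma IsSolution.wronskian_eq {θ σ : ℝ} {u v : ℝ → ℂ} (hu : IsSolution 1 θ σ u)
    (hv : IsSolution 1 θ σ v) (x y : ℝ) :
    u x * deriv v x - deriv u x * v x = u y * deriv v y - deriv u y * v y := by
  have h : ∀ x, HasDerivAt (fun x => u x * deriv v x - deriv u x * v x) 0 x := fun x =>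
    (((hu.1 x).hasDerivAt.mul (hv.2 x)).sub
      ((hu.2 x).mul (hv.1 x).hasDerivAt)).congr_deriv (by ring)
  exact is_const_of_deriv_eq_zero (fun X => (h X).differentiableAt) (fun X => (h X).deriv) x y

/-- Every solution is the combination of the two fundamental solutions prescribed by its data
at `0`. As the fundamental solutions are explicit, this follows from the constancy of
Wronskians. -/
lemma IsSolution.eq_add {θ σ : ℝ} (hθ : 0 < θ) {u : ℝ → ℂ} (hu : IsSolution 1 θ σ u) (x : ℝ) :
    u x = u 0 * cauchySol θ σ 1 0 x + deriv u 0 * cauchySol θ σ 0 1 x := by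
  have h1 := isSolution_cauchySol hθ σ 1 0
  have h2 := isSolution_cauchySol hθ σ 0 1
  have e1 := hu.wronskian_eq h2 x 0
  have e2 := hu.wronskian_eq h1 x 0
  have e3 := h1.wronskian_eq h2 x 0
  simp only [cauchySol_zero, deriv_cauchySol_zero hθ] at e1 e2 e3
  linear_combination (-u x) * e3 + cauchySol θ σ 1 0 x * e1 - cauchySol θ σ 0 1 x * e2

lemma IsSolution.ext {θ σ : ℝ} (hθ : 0 < θ) {u v : ℝ → ℂ} (hu : IsSolution 1 θ σ u)
    (hv : IsSolution 1 θ σ v) (h0 : u 0 = v 0) (h1 : deriv u 0 = deriv v 0) : u = v := by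
  funext x
  rw [hu.eq_add hθ x, hv.eq_add hθ x, h0, h1]

lemma IsSolution.deriv_smul_add_smul_zero {θ σ : ℝ} {u v : ℝ → ℂ} (hu : IsSolution 1 θ σ u)
    (hv : IsSolution 1 θ σ v) (a b : ℂ) (x : ℝ) :
    deriv (a • u + b • v) x = a * deriv u x + b * deriv v x :=
  (((hu.1 x).hasDerivAt.const_smul a).add ((hv.1 x).hasDerivAt.const_smul b)).deriv

end Cauchy

section Polarized

open Complex

/-! ### Decaying solutions -/

lemma inner_mul_self_left (m w : ℂ) : inner ℝ (m * w) w = m.re * ‖w‖ ^ 2 := by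
  rw [Complex.inner, Complex.sq_norm, normSq_apply]
  simp
  ring

lemma inner_self_mul_right (m w : ℂ) : inner ℝ w (m * w) = m.re * ‖w‖ ^ 2 := by
  rw [real_inner_comm, inner_mul_self_left]

lemma one_le_invSpeedSq {θ : ℝ} (hθ : 0 < θ) (x : ℝ) : 1 ≤ invSpeedSq 1 θ x := by
  rw [invSpeedSq_one]
  have : 0 ≤ max x 0 := le_max_right _ _
  nlinarith

/-- The derivative of a decaying solution grows at most polynomially. -/
lemma IsSolution.exists_norm_deriv_le {θ σ : ℝ} (hθ : 0 < θ) {u : ℝ → ℂ}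
    (hu : IsSolution 1 θ σ u) (hlim : Tendsto u atTop (𝓝 0)) :
    ∃ D : ℝ, ∀ᶠ x in atTop, ‖u x‖ ≤ 1 ∧
      ‖deriv u x‖ ≤ D + ‖waveNumber σ‖ ^ 2 * (1 + θ * x) * x := by
  have h1 : ∀ᶠ x in atTop, ‖u x‖ ≤ 1 := by
    have := hlim.norm
    rw [norm_zero] at this
    exact this.eventually (eventually_le_nhds one_pos)
  obtain ⟨x₀, hx₀⟩ := eventually_atTop.1 (h1.and (eventually_ge_atTop 0))
  have hx₀0 : 0 ≤ x₀ := (hx₀ x₀ le_rfl).2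
  refine ⟨‖deriv u x₀‖, ?_⟩
  filter_upwards [eventually_ge_atTop x₀] with x hx
  refine ⟨(hx₀ x hx).1, ?_⟩
  have h2 := norm_image_sub_le_of_norm_deriv_le_segment' (f := deriv u) (a := x₀) (b := x)
    (C := ‖waveNumber σ‖ ^ 2 * (1 + θ * x)) (fun y _ => (hu.2 y).hasDerivWithinAt)
    (fun y hy => ?_) x (Set.right_mem_Icc.2 hx)
  · have h3 := norm_le_norm_add_norm_sub' (deriv u x) (deriv u x₀)
    refine h3.trans (add_le_add le_rfl (h2.trans ?_))
    have : 0 ≤ x := hx₀0.trans hx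
    exact mul_le_mul_of_nonneg_left (by linarith) (by positivity)
  · have hy0 : 0 ≤ y := hx₀0.trans hy.1
    have hρ : (0 : ℝ) ≤ 1 + θ * y := by positivity
    rw [norm_neg, norm_mul, norm_mul, norm_pow, norm_real, invSpeedSq_one, max_eq_left hy0,
      Real.norm_eq_abs, abs_of_nonneg hρ]
    refine (mul_le_of_le_one_right (by positivity) (hx₀ y hy.1).1).trans ?_
    have : θ * y ≤ θ * x := mul_le_mul_of_nonneg_left hy.2.le hθ.le
    exact mul_le_mul_of_nonneg_left (by linarith) (by positivity)

/-- The energy inequality. For `m² = -k²` with `Re m > 0`, the quantity `G = Re (conj (m u) u')`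
satisfies `G' ≥ 2 Re(m) G`. If it were positive somewhere it would grow exponentially, whereas `u'`
grows at most polynomially when `u` decays. -/
lemma IsSolution.inner_nonpos {θ σ : ℝ} (hθ : 0 < θ) {u : ℝ → ℂ} (hu : IsSolution 1 θ σ u)
    (hlim : Tendsto u atTop (𝓝 0)) {m : ℂ} (hm : m ^ 2 = -waveNumber σ ^ 2) (hre : 0 < m.re) :
    inner ℝ (m * u 0) (deriv u 0) ≤ 0 := by
  set G : ℝ → ℝ := fun x => inner ℝ (m * u x) (deriv u x) with hG
  set c : ℝ := 2 * m.re with hc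
  have hcpos : 0 < c := by positivity
  have hGd : ∀ x, HasDerivAt G
      (m.re * (‖deriv u x‖ ^ 2 + invSpeedSq 1 θ x * ‖m * u x‖ ^ 2)) x := by
    intro x
    refine (((hu.1 x).hasDerivAt.const_mul m).inner ℝ (hu.2 x)).congr_deriv ?_
    have h1 : -((1 + I * (σ : ℂ)) ^ 2 * (invSpeedSq 1 θ x : ℂ) * u x)
        = invSpeedSq 1 θ x • (m * (m * u x)) := by
      rw [real_smul]
      have hm' : m ^ 2 = -(1 + I * (σ : ℂ)) ^ 2 := hm
      linear_combination (-(invSpeedSq 1 θ x : ℂ) * u x) * hm'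
    rw [h1, real_inner_smul_right, inner_self_mul_right, inner_mul_self_left]
    ring
  have hGle : ∀ x, c * G x ≤ m.re * (‖deriv u x‖ ^ 2 + invSpeedSq 1 θ x * ‖m * u x‖ ^ 2) := by
    intro x
    have h1 : G x ≤ ‖m * u x‖ * ‖deriv u x‖ := real_inner_le_norm _ _
    have h2 : ‖m * u x‖ ^ 2 ≤ invSpeedSq 1 θ x * ‖m * u x‖ ^ 2 :=
      le_mul_of_one_le_left (by positivity) (one_le_invSpeedSq hθ x)
    have h3 : 2 * G x ≤ ‖deriv u x‖ ^ 2 + invSpeedSq 1 θ x * ‖m * u x‖ ^ 2 := by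
      nlinarith [sq_nonneg (‖m * u x‖ - ‖deriv u x‖)]
    rw [hc]
    calc 2 * m.re * G x = m.re * (2 * G x) := by ring
      _ ≤ _ := mul_le_mul_of_nonneg_left h3 hre.le
  have hmono : Monotone fun x => G x * Real.exp (-c * x) := by
    have hd : ∀ x, HasDerivAt (fun x => G x * Real.exp (-c * x))
        ((m.re * (‖deriv u x‖ ^ 2 + invSpeedSq 1 θ x * ‖m * u x‖ ^ 2) - c * G x)
          * Real.exp (-c * x)) x := by
      intro x
      refine ((hGd x).mul ((hasDerivAt_id x).const_mul (-c)).exp).congr_deriv ?_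
      simp only [id]
      ring
    refine monotone_of_deriv_nonneg (fun x => (hd x).differentiableAt) fun x => ?_
    rw [(hd x).deriv]
    exact mul_nonneg (sub_nonneg.2 (hGle x)) (Real.exp_pos _).le
  obtain ⟨D, hD⟩ := hu.exists_norm_deriv_le hθ hlim
  set K : ℝ := ‖waveNumber σ‖ ^ 2
  have hzero : Tendsto (fun x : ℝ => ‖m‖ * (D + K * (1 + θ * x) * x) * Real.exp (-c * x)) atTop
      (𝓝 0) := by
    have hp := fun n : ℕ => tendsto_rpow_mul_exp_neg_mul_atTop_nhds_zero n c hcpos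
    simp only [Real.rpow_natCast] at hp
    have h := (((hp 0).const_mul (‖m‖ * D)).add ((hp 1).const_mul (‖m‖ * K))).add
      ((hp 2).const_mul (‖m‖ * K * θ))
    simp only [mul_zero, add_zero] at h
    refine h.congr fun x => ?_
    ring
  have h0 : G 0 ≤ 0 := by
    refine ge_of_tendsto hzero ?_
    filter_upwards [hD, eventually_ge_atTop 0] with x hx hx0
    have h1 : G 0 ≤ G x * Real.exp (-c * x) := by simpa using hmono hx0
    refine h1.trans (mul_le_mul_of_nonneg_right ?_ (Real.exp_pos _).le)
    refine (real_inner_le_norm _ _).trans ?_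
    rw [norm_mul]
    exact mul_le_mul (mul_le_of_le_one_right (norm_nonneg _) hx.1) hx.2 (norm_nonneg _)
      (norm_nonneg _)
  exact h0

/-- For `σ ≠ 0` not every solution decays at `+∞`: the one with `u'(0) = m u(0)` has positive
energy. -/
lemma exists_not_tendsto_atTop {θ σ : ℝ} (hθ : 0 < θ) (hσ : σ ≠ 0) :
    ∃ g, IsSolution 1 θ σ g ∧ ¬ Tendsto g atTop (𝓝 0) := by
  obtain ⟨m, hm, hre⟩ : ∃ m : ℂ, m ^ 2 = -waveNumber σ ^ 2 ∧ 0 < m.re := by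
    rcases lt_or_gt_of_ne hσ with h | h
    · refine ⟨I * waveNumber σ, ?_, ?_⟩
      · rw [mul_pow, I_sq]
        ring
      · simpa [waveNumber] using h
    · refine ⟨-(I * waveNumber σ), ?_, ?_⟩
      · rw [neg_sq, mul_pow, I_sq]
        ring
      · simpa [waveNumber] using h
  refine ⟨cauchySol θ σ 1 m, isSolution_cauchySol hθ σ 1 m, fun h => ?_⟩
  have h1 := (isSolution_cauchySol hθ σ 1 m).inner_nonpos hθ h hm hre
  rw [cauchySol_zero, deriv_cauchySol_zero hθ, mul_one, real_inner_self_eq_norm_sq] at h1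
  have h2 : m ≠ 0 := by
    rintro rfl
    simp at hre
  have : 0 < ‖m‖ := norm_pos_iff.2 h2
  exact absurd h1 (not_le.2 (by positivity))

/-- As soon as one solution does not decay, any two decaying solutions are proportional. -/
lemma IsSolution.mul_eq_mul_of_tendsto_zero {θ σ : ℝ} (hθ : 0 < θ) {l : Filter ℝ}
    (hnd : ∃ g, IsSolution 1 θ σ g ∧ ¬ Tendsto g l (𝓝 0)) {u v : ℝ → ℂ}
    (hu : IsSolution 1 θ σ u) (hv : IsSolution 1 θ σ v) (hul : Tendsto u l (𝓝 0))
    (hvl : Tendsto v l (𝓝 0)) (x y : ℝ) : u x * v y = u y * v x := by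
  by_cases hW : u 0 * deriv v 0 - deriv u 0 * v 0 = 0
  · rw [hu.eq_add hθ x, hv.eq_add hθ y, hu.eq_add hθ y, hv.eq_add hθ x]
    linear_combination (cauchySol θ σ 1 0 x * cauchySol θ σ 0 1 y
      - cauchySol θ σ 1 0 y * cauchySol θ σ 0 1 x) * hW
  · obtain ⟨g, hg, hgl⟩ := hnd
    refine absurd ?_ hgl
    set W := u 0 * deriv v 0 - deriv u 0 * v 0 with hWdef
    have hgeq : g = ((g 0 * deriv v 0 - deriv g 0 * v 0) / W) • u
        + ((u 0 * deriv g 0 - deriv u 0 * g 0) / W) • v := by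
      refine hg.ext hθ ((hu.smul _).add (hv.smul _)) ?_ ?_
      · simp only [Pi.add_apply, Pi.smul_apply, smul_eq_mul]
        field_simp
        rw [hWdef]
        ring
      · rw [hu.deriv_smul_add_smul_zero hv]
        field_simp
        rw [hWdef]
        ring
    rw [hgeq]
    have := (hul.const_smul ((g 0 * deriv v 0 - deriv g 0 * v 0) / W)).add
      (hvl.const_smul ((u 0 * deriv g 0 - deriv u 0 * g 0) / W))
    simp only [smul_zero, add_zero] at this
    exact this

/-- A jointly continuous family of decaying solutions determines the limiting absorption space. -/
lemma polarizedSpace_eq_span {θ : ℝ} (hθ : 0 < θ) {S : Set ℝ} [(𝓝[S] (0 : ℝ)).NeBot]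
    {l : Filter ℝ} {U : ℝ → ℝ → ℂ} (hU : ∀ σ, IsSolution 1 θ σ (U σ))
    (hcont : Continuous fun q : ℝ × ℝ => U q.1 q.2) (h0 : U 0 ≠ 0)
    (hUl : ∀ σ ∈ S, Tendsto (U σ) l (𝓝 0))
    (hnd : ∀ σ ∈ S, ∃ g, IsSolution 1 θ σ g ∧ ¬ Tendsto g l (𝓝 0)) :
    polarizedSpace 1 θ S l = Submodule.span ℂ {U 0} := by
  refine le_antisymm ?_ ?_
  · rintro v ⟨-, V, hV, hVlim⟩
    obtain ⟨y, hy⟩ : ∃ y, U 0 y ≠ 0 := Function.ne_iff.1 h0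
    have hprop : ∀ x, v x * U 0 y = v y * U 0 x := by
      intro x
      have hVt : ∀ x, Tendsto (fun σ => V σ x) (𝓝[S] 0) (𝓝 (v x)) := fun x =>
        (hVlim {x} isCompact_singleton).tendsto_at (Set.mem_singleton x)
      have hUt : ∀ x, Tendsto (fun σ => U σ x) (𝓝[S] 0) (𝓝 (U 0 x)) := fun x =>
        ((hcont.comp (continuous_id.prodMk continuous_const)).tendsto 0).mono_left
          nhdsWithin_le_nhds
      refine tendsto_nhds_unique_of_eventuallyEq ((hVt x).mul (hUt y)) ((hVt y).mul (hUt x)) ?_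
      filter_upwards [self_mem_nhdsWithin] with σ hσ
      exact (hV σ hσ).1.mul_eq_mul_of_tendsto_zero hθ (hnd σ hσ) (hU σ) (hV σ hσ).2 (hUl σ hσ) x y
    refine Submodule.mem_span_singleton.2 ⟨v y / U 0 y, ?_⟩
    funext x
    rw [Pi.smul_apply, smul_eq_mul, div_mul_eq_mul_div, div_eq_iff hy, hprop]
  · rw [Submodule.span_le, Set.singleton_subset_iff]
    refine ⟨hU 0, U, fun σ hσ => ⟨hU σ, hUl σ hσ⟩, ?_⟩
    let F : C(ℝ, C(ℝ, ℂ)) := ContinuousMap.curry ⟨fun q : ℝ × ℝ => U q.1 q.2, hcont⟩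
    have hF : Tendsto F (𝓝[S] 0) (𝓝 (F 0)) := (F.continuous.tendsto 0).mono_left nhdsWithin_le_nhds
    exact ContinuousMap.tendsto_iff_forall_isCompact_tendstoUniformlyOn.1 hF

/-! ### Waves at `-∞` -/

/-- The solution of the extended equation which is the exponential `e^{iεkx}` for `x ≤ 0`, where
`ε = ±1`. -/
noncomputable def expWave (θ : ℝ) (ε : ℂ) (σ : ℝ) : ℝ → ℂ :=
  cauchySol θ σ 1 (ε * I * waveNumber σ)

lemma expWave_of_nonpos (θ : ℝ) {ε : ℂ} (hε : ε ^ 2 = 1) (σ : ℝ) {x : ℝ} (hx : x ≤ 0) :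
    expWave θ ε σ x = exp (ε * I * waveNumber σ * x) := by
  have hk := waveNumber_ne_zero σ
  have h1 : ε * I * waveNumber σ * x = ε * (waveNumber σ * x) * I := by ring
  rw [expWave, cauchySol, if_pos hx, h1, exp_mul_I]
  rcases mul_self_eq_one_iff.1 ((sq ε).symm.trans hε) with rfl | rfl
  · field_simp
  · rw [neg_one_mul (waveNumber σ * (x : ℂ)), Complex.cos_neg, Complex.sin_neg]
    field_simp

lemma isSolution_expWave {θ : ℝ} (hθ : 0 < θ) (ε : ℂ) (σ : ℝ) :
    IsSolution 1 θ σ (expWave θ ε σ) :=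
  isSolution_cauchySol hθ σ _ _

lemma expWave_apply_zero (θ : ℝ) (ε : ℂ) (σ : ℝ) : expWave θ ε σ 0 = 1 := cauchySol_zero _ _ _ _

lemma deriv_expWave_zero {θ : ℝ} (hθ : 0 < θ) (ε : ℂ) :
    deriv (expWave θ ε 0) 0 = ε * I := by
  rw [expWave, deriv_cauchySol_zero hθ, waveNumber_zero, mul_one]

lemma continuous_expWave {θ : ℝ} (hθ : 0 < θ) (ε : ℂ) :
    Continuous fun q : ℝ × ℝ => expWave θ ε q.1 q.2 :=
  continuous_cauchySol hθ (a := fun _ => 1) (b := fun σ => ε * I * waveNumber σ) continuous_const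
    (continuous_const.mul continuous_waveNumber)

lemma norm_expWave_of_nonpos (θ : ℝ) {ε : ℝ} (hε : ε ^ 2 = 1) (σ : ℝ) {x : ℝ} (hx : x ≤ 0) :
    ‖expWave θ ε σ x‖ = Real.exp (-(ε * σ) * x) := by
  rw [expWave_of_nonpos θ (by exact_mod_cast hε) σ hx, norm_exp]
  congr 1
  simp [waveNumber]

lemma tendsto_expWave_atBot (θ : ℝ) {ε : ℝ} (hε : ε ^ 2 = 1) {σ : ℝ} (hσ : ε * σ < 0) :
    Tendsto (expWave θ ε σ) atBot (𝓝 0) := by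
  rw [tendsto_zero_iff_norm_tendsto_zero]
  have h : Tendsto (fun x => Real.exp (-(ε * σ) * x)) atBot (𝓝 0) :=
    Real.tendsto_exp_atBot.comp (tendsto_id.const_mul_atBot (neg_pos.2 hσ))
  refine h.congr' ?_
  filter_upwards [eventually_le_atBot 0] with x hx
  rw [norm_expWave_of_nonpos θ hε σ hx]

/-- The exponential of the opposite sign does not decay at `-∞`. -/
lemma exists_not_tendsto_atBot {θ : ℝ} (hθ : 0 < θ) {ε : ℝ} (hε : ε ^ 2 = 1) {σ : ℝ}
    (hσ : ε * σ < 0) : ∃ g, IsSolution 1 θ σ g ∧ ¬ Tendsto g atBot (𝓝 0) := by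
  refine ⟨_, isSolution_expWave hθ ((-ε : ℝ) : ℂ) σ, fun h => ?_⟩
  have h1 := h.norm
  rw [norm_zero] at h1
  refine absurd (ge_of_tendsto h1 ?_) (not_le.2 one_pos)
  filter_upwards [eventually_le_atBot 0] with x hx
  rw [norm_expWave_of_nonpos θ (by rwa [neg_sq]) σ hx, Real.one_le_exp_iff]
  nlinarith

lemma expWave_ne_zero (θ : ℝ) (ε : ℂ) (σ : ℝ) : expWave θ ε σ ≠ 0 := fun h => by
  simpa [h] using expWave_apply_zero θ ε σ

lemma outgoingAtBot_eq_span {θ : ℝ} (hθ : 0 < θ) :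
    outgoingAtBot 1 θ = Submodule.span ℂ {expWave θ (1 : ℝ) 0} :=
  polarizedSpace_eq_span hθ (isSolution_expWave hθ _) (continuous_expWave hθ _)
    (expWave_ne_zero _ _ _)
    (fun σ hσ => tendsto_expWave_atBot θ (by norm_num) (by simpa using hσ))
    (fun σ hσ => exists_not_tendsto_atBot hθ (ε := 1) (by norm_num) (by simpa using hσ))

lemma incomingAtBot_eq_span {θ : ℝ} (hθ : 0 < θ) :
    incomingAtBot 1 θ = Submodule.span ℂ {expWave θ (-1 : ℝ) 0} :=
  polarizedSpace_eq_span hθ (isSolution_expWave hθ _) (continuous_expWave hθ _)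
    (expWave_ne_zero _ _ _)
    (fun σ hσ => tendsto_expWave_atBot θ (by norm_num) (by simpa using hσ))
    (fun σ hσ => exists_not_tendsto_atBot hθ (ε := -1) (by norm_num) (by simpa using hσ))

/-! ### Waves at `+∞` -/

/-- The solution of the extended equation which is `w(k^{2/3} β (1 + θx))` for `x ≥ 0`. -/
noncomputable def rampWave (θ : ℝ) (w : ℂ → ℂ) (σ : ℝ) : ℝ → ℂ :=
  cauchySol θ σ (w (rampVar θ σ 0)) (rampVarDeriv θ σ * deriv w (rampVar θ σ 0))

lemma isSolution_rampWave {θ : ℝ} (hθ : 0 < θ) (w : ℂ → ℂ) (σ : ℝ) :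
    IsSolution 1 θ σ (rampWave θ w σ) :=
  isSolution_cauchySol hθ σ _ _

lemma rampWave_of_nonneg {θ : ℝ} (hθ : 0 < θ) {w : ℂ → ℂ} (hw : IsRotatedAiry w) (σ : ℝ) {x : ℝ}
    (hx : 0 ≤ x) : rampWave θ w σ x = w (rampVar θ σ x) := by
  rcases hx.eq_or_lt with rfl | hx
  · exact cauchySol_zero _ _ _ _
  · rw [rampWave, cauchySol, if_neg (not_le.2 hx),
      mul_div_cancel_left₀ _ (rampVarDeriv_ne_zero hθ σ), hw.airyCauchy_eq]

lemma continuous_rampWave {θ : ℝ} (hθ : 0 < θ) {w : ℂ → ℂ} (hw : IsRotatedAiry w) :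
    Continuous fun q : ℝ × ℝ => rampWave θ w q.1 q.2 := by
  have h1 : Continuous fun σ : ℝ => rampVar θ σ 0 := by
    have := continuous_waveNumberCbrt
    unfold rampVar
    fun_prop
  have h2 := continuous_rampVarDeriv θ
  have h3 := hw.continuous
  have h4 := hw.continuous_deriv
  have ha : Continuous fun σ : ℝ => w (rampVar θ σ 0) := h3.comp h1
  have hb : Continuous fun σ : ℝ => rampVarDeriv θ σ * deriv w (rampVar θ σ 0) :=
    h2.mul (h4.comp h1)
  have h5 := continuous_cauchySol hθ ha hb
  exact h5

lemma rampVar_zero_left (θ x : ℝ) :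
    rampVar θ 0 x = (beta θ : ℂ) * (1 + (θ : ℂ) * (x : ℂ)) := by
  rw [rampVar, waveNumberCbrt_zero, one_pow, one_mul]

lemma rampVar_zero_zero (θ : ℝ) : rampVar θ 0 0 = (beta θ : ℂ) := by
  simp [rampVar_zero_left]

/-- On `x ≥ 0` the ramp solution is given by the formula, so its data at `0` are determined. -/
lemma isRampSolutionOf_iff {θ : ℝ} (hθ : 0 < θ) {w : ℂ → ℂ} (hw : IsRotatedAiry w) (u : ℝ → ℂ) :
    IsRampSolutionOf θ w u ↔ u = rampWave θ w 0 := by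
  have hv : IsRampSolutionOf θ w (rampWave θ w 0) :=
    ⟨isSolution_rampWave hθ w 0, fun x hx => by
      rw [rampWave_of_nonneg hθ hw 0 hx, rampVar_zero_left]⟩
  refine ⟨fun hu => ?_, fun h => h ▸ hv⟩
  have hagree : ∀ x ∈ Set.Ici (0 : ℝ), u x = rampWave θ w 0 x := fun x hx =>
    (hu.2 x hx).trans (hv.2 x hx).symm
  refine hu.1.ext hθ hv.1 (hagree 0 Set.self_mem_Ici) ?_
  have h1 := (hu.1.1 0).hasDerivAt.hasDerivWithinAt (s := Set.Ici 0)
  have h2 := ((hv.1.1 0).hasDerivAt.hasDerivWithinAt (s := Set.Ici 0)).congr hagree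
    (hagree 0 Set.self_mem_Ici)
  exact (uniqueDiffOn_Ici (0 : ℝ) 0 Set.self_mem_Ici).eq_deriv _ h1 h2

lemma tendsto_beta_mul {θ : ℝ} (hθ : 0 < θ) :
    Tendsto (fun x : ℝ => beta θ * (1 + θ * x)) atTop atTop :=
  (tendsto_atTop_add_const_left _ 1 (tendsto_id.const_mul_atTop hθ)).const_mul_atTop (beta_pos hθ)

lemma tendsto_rampWave_atTop {θ : ℝ} (hθ : 0 < θ) {η : ℂ} (hη : η ^ 6 = -1) {σ : ℝ}
    (hre : 0 < (η * waveNumberCbrt σ).re) (hre3 : 0 ≤ (η ^ 3 * waveNumber σ).re) :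
    Tendsto (rampWave θ (fun X => airyAi (η ^ 2 * X)) σ) atTop (𝓝 0) := by
  rw [← waveNumberCbrt_pow_three, ← mul_pow] at hre3
  refine ((tendsto_airyAi_zero hre hre3).comp (tendsto_beta_mul hθ)).congr' ?_
  filter_upwards [eventually_ge_atTop 0] with x hx
  rw [rampWave_of_nonneg hθ (isRotatedAiry_airyAi_rotate hη) σ hx, rampVar, Function.comp_apply]
  congr 1
  push_cast
  ring

lemma rampWave_ne_zero {θ : ℝ} (hθ : 0 < θ) {η : ℂ} (hη : η ^ 6 = -1) (hre : 0 < η.re) :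
    rampWave θ (fun X => airyAi (η ^ 2 * X)) 0 ≠ 0 := by
  intro h
  obtain ⟨C, hC0, hC⟩ := exists_tendsto_airyAi hre
  refine hC0 (tendsto_nhds_unique_of_eventuallyEq hC tendsto_const_nhds ?_)
  have h4 : Tendsto (fun q : ℝ => q ^ 4) atTop atTop := tendsto_pow_atTop (by norm_num)
  filter_upwards [h4.eventually_ge_atTop (beta θ)] with q hq
  have hβ := beta_pos hθ
  -- the point `x` at which `β (1 + θx) = q⁴`
  have hx : 0 ≤ (q ^ 4 / beta θ - 1) / θ := by
    refine div_nonneg (sub_nonneg.2 ?_) hθ.le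
    rwa [le_div_iff₀ hβ, one_mul]
  have h1 := rampWave_of_nonneg hθ (isRotatedAiry_airyAi_rotate hη) 0 hx
  have h2 : rampVar θ 0 ((q ^ 4 / beta θ - 1) / θ) = (q : ℂ) ^ 4 := by
    have : beta θ * (1 + θ * ((q ^ 4 / beta θ - 1) / θ)) = q ^ 4 := by
      field_simp
      ring
    rw [rampVar_zero_left]
    exact_mod_cast this
  rw [h, h2] at h1
  rw [← h1]
  simp

lemma exp_mul_I_mul_waveNumberCbrt_re_pos {t : ℝ} (ht : |t| ≤ Real.pi / 6) (σ : ℝ) :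
    0 < (exp ((t : ℂ) * I) * waveNumberCbrt σ).re := by
  rw [waveNumberCbrt, ← exp_add, exp_re]
  refine mul_pos (Real.exp_pos _) (Real.cos_pos_of_mem_Ioo ?_)
  have him : ((t : ℂ) * I + log (waveNumber σ) / 3).im = t + (waveNumber σ).arg / 3 := by
    rw [add_im, im_ofReal_mul, I_im, mul_one, ← log_im]
    congr 1
    exact div_ofNat_im _ 3
  have harg : |(waveNumber σ).arg| < Real.pi / 2 :=
    abs_arg_lt_pi_div_two_iff.2 (Or.inl (by simp [waveNumber_re]))
  rw [him]
  rw [abs_lt] at harg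
  rw [abs_le] at ht
  constructor <;> linarith

lemma rotPlus_mul_re_pos (σ : ℝ) : 0 < (rotPlus * waveNumberCbrt σ).re :=
  exp_mul_I_mul_waveNumberCbrt_re_pos (abs_of_pos (by positivity)).le σ

lemma rotMinus_mul_re_pos (σ : ℝ) : 0 < (rotMinus * waveNumberCbrt σ).re :=
  exp_mul_I_mul_waveNumberCbrt_re_pos (by rw [abs_neg]; exact (abs_of_pos (by positivity)).le) σ

lemma rotPlus_re_pos : 0 < rotPlus.re := by
  simpa [waveNumberCbrt_zero] using rotPlus_mul_re_pos 0

lemma rotMinus_re_pos : 0 < rotMinus.re := by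
  simpa [waveNumberCbrt_zero] using rotMinus_mul_re_pos 0

lemma tendsto_rampWave_wPlus {θ : ℝ} (hθ : 0 < θ) {σ : ℝ} (hσ : σ < 0) :
    Tendsto (rampWave θ wPlus σ) atTop (𝓝 0) := by
  rw [wPlus_eq]
  refine tendsto_rampWave_atTop hθ rotPlus_pow_six (rotPlus_mul_re_pos σ) ?_
  rw [rotPlus_pow_three]
  simpa [waveNumber] using hσ.le

lemma tendsto_rampWave_wMinus {θ : ℝ} (hθ : 0 < θ) {σ : ℝ} (hσ : 0 < σ) :
    Tendsto (rampWave θ wMinus σ) atTop (𝓝 0) := by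
  rw [wMinus_eq]
  refine tendsto_rampWave_atTop hθ rotMinus_pow_six (rotMinus_mul_re_pos σ) ?_
  rw [rotMinus_pow_three]
  simpa [waveNumber] using hσ.le

lemma rampWave_wPlus_ne_zero {θ : ℝ} (hθ : 0 < θ) : rampWave θ wPlus 0 ≠ 0 :=
  wPlus_eq ▸ rampWave_ne_zero hθ rotPlus_pow_six rotPlus_re_pos

lemma rampWave_wMinus_ne_zero {θ : ℝ} (hθ : 0 < θ) : rampWave θ wMinus 0 ≠ 0 :=
  wMinus_eq ▸ rampWave_ne_zero hθ rotMinus_pow_six rotMinus_re_pos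

lemma outgoingAtTop_eq_span {θ : ℝ} (hθ : 0 < θ) :
    outgoingAtTop 1 θ = Submodule.span ℂ {rampWave θ wPlus 0} :=
  polarizedSpace_eq_span hθ (isSolution_rampWave hθ _) (continuous_rampWave hθ isRotatedAiry_wPlus)
    (rampWave_wPlus_ne_zero hθ) (fun _ hσ => tendsto_rampWave_wPlus hθ hσ)
    (fun _ hσ => exists_not_tendsto_atTop hθ (ne_of_lt hσ))

lemma incomingAtTop_eq_span {θ : ℝ} (hθ : 0 < θ) :
    incomingAtTop 1 θ = Submodule.span ℂ {rampWave θ wMinus 0} :=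
  polarizedSpace_eq_span hθ (isSolution_rampWave hθ _) (continuous_rampWave hθ isRotatedAiry_wMinus)
    (rampWave_wMinus_ne_zero hθ) (fun _ hσ => tendsto_rampWave_wMinus hθ hσ)
    (fun _ hσ => exists_not_tendsto_atTop hθ (ne_of_gt hσ))

end Polarized

section Reflection

open Complex

/-! ### Normalization against the WKB functions -/

lemma rpow_quarter_pow_four {y : ℝ} (hy : 0 ≤ y) : (y ^ (1 / 4 : ℝ)) ^ 4 = y := by
  rw [← Real.rpow_natCast, ← Real.rpow_mul hy]
  norm_num

lemma sqrt_speed_of_nonneg {θ x : ℝ} (hθ : 0 < θ) (hx : 0 ≤ x) :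
    √(speed 1 θ x) = ((1 + θ * x) ^ (1 / 4 : ℝ))⁻¹ := by
  have hy : 0 ≤ 1 + θ * x := by positivity
  have h := rpow_quarter_pow_four hy
  set r := (1 + θ * x) ^ (1 / 4 : ℝ)
  have hr : 0 ≤ r := Real.rpow_nonneg hy _
  rw [speed, invSpeedSq_one, max_eq_left hx, ← h, show r ^ 4 = (r ^ 2) ^ 2 by ring,
    Real.sqrt_sq (by positivity), one_div, Real.sqrt_inv, Real.sqrt_sq hr]

lemma phase_of_nonneg {θ x : ℝ} (hθ : 0 < θ) (hx : 0 ≤ x) :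
    phase 1 θ x = 2 / (3 * θ) * (((1 + θ * x) ^ (1 / 4 : ℝ)) ^ 6 - 1) := by
  have hcongr : phase 1 θ x = ∫ y in (0 : ℝ)..x, √(1 + θ * y) := by
    refine intervalIntegral.integral_congr fun y hy => ?_
    rw [Set.uIcc_of_le hx] at hy
    simp only [speed, one_div, inv_inv, invSpeedSq_one, max_eq_left hy.1]
  have hd : ∀ y ∈ Set.uIcc 0 x,
      HasDerivAt (fun y => 2 / (3 * θ) * (1 + θ * y) ^ (3 / 2 : ℝ)) (√(1 + θ * y)) y := by
    intro y hy
    rw [Set.uIcc_of_le hx] at hy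
    have hy0 : 0 ≤ y := hy.1
    have hpos : 0 < 1 + θ * y := by positivity
    have h := ((((hasDerivAt_id y).const_mul θ).const_add 1).rpow_const (p := 3 / 2)
      (Or.inl hpos.ne')).const_mul (2 / (3 * θ))
    refine h.congr_deriv ?_
    rw [Real.sqrt_eq_rpow]
    norm_num
    field_simp
  rw [hcongr, intervalIntegral.integral_eq_sub_of_hasDerivAt hd
    (Continuous.intervalIntegrable (by fun_prop) _ _), ← Real.rpow_natCast,
    ← Real.rpow_mul (by positivity)]
  norm_num
  ring

lemma wkbRight_of_nonpos {θ x : ℝ} (hx : x ≤ 0) : wkbRight 1 θ x = exp (-(I * x)) := by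
  have hs : ∀ y ≤ (0 : ℝ), speed 1 θ y = 1 := fun y hy => by
    simp [speed, invSpeedSq_one, max_eq_right hy]
  have hp : phase 1 θ x = x := by
    have : phase 1 θ x = ∫ y in (0 : ℝ)..x, (1 : ℝ) := by
      refine intervalIntegral.integral_congr fun y hy => ?_
      rw [Set.uIcc_of_ge hx] at hy
      simp [hs y hy.2]
    simpa using this
  simp [wkbRight, hs x hx, hp]

lemma wkbLeft_eq_inv {α θ x : ℝ} (h : speed α θ x = 1) :
    wkbLeft α θ x = (wkbRight α θ x)⁻¹ := by
  simp [wkbLeft, wkbRight, h, ← exp_neg]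

lemma wkbLeft_of_nonpos {θ x : ℝ} (hx : x ≤ 0) : wkbLeft 1 θ x = exp (I * x) := by
  rw [wkbLeft_eq_inv (by simp [speed, invSpeedSq_one, max_eq_right hx]), wkbRight_of_nonpos hx,
    ← exp_neg, neg_neg]

lemma beta_rpow_quarter_pow_six {θ : ℝ} (hθ : 0 < θ) : (beta θ ^ (1 / 4 : ℝ)) ^ 6 * θ = 1 := by
  rw [beta, ← Real.rpow_natCast, ← Real.rpow_mul hθ.le, ← Real.rpow_mul hθ.le]
  nth_rewrite 2 [← Real.rpow_one θ]
  rw [← Real.rpow_add hθ]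
  norm_num

lemma beta_rpow_half {θ : ℝ} (hθ : 0 < θ) : beta θ ^ (1 / 2 : ℝ) * (beta θ * θ) = 1 := by
  nth_rewrite 2 [beta]
  rw [beta, ← Real.rpow_mul hθ.le]
  nth_rewrite 3 [← Real.rpow_one θ]
  rw [← Real.rpow_add hθ, ← Real.rpow_add hθ]
  norm_num

/-- The ramp solution built from `w₊` is a multiple of the right-going WKB function up to a factor
tending to `1`. With `q = (β (1 + θx))^{1/4}`, both the amplitude `q` and the phase `(2/3) q⁶` of
the Airy asymptotics match those of the WKB function. -/
lemma exists_tendsto_rampWave_div_wkbRight {θ : ℝ} (hθ : 0 < θ) :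
    ∃ C : ℂ, C ≠ 0 ∧
      Tendsto (fun x => rampWave θ wPlus 0 x / wkbRight 1 θ x) atTop (𝓝 C) := by
  obtain ⟨C, hC0, hC⟩ := exists_tendsto_airyAi rotPlus_re_pos
  have hβ := beta_pos hθ
  set b := beta θ ^ (1 / 4 : ℝ) with hb
  have hb0 : 0 < b := Real.rpow_pos_of_pos hβ _
  have hb0' : (b : ℂ) ≠ 0 := ofReal_ne_zero.2 hb0.ne'
  have hθ' : (θ : ℂ) ≠ 0 := ofReal_ne_zero.2 hθ.ne'
  have hb4 : b ^ 4 = beta θ := rpow_quarter_pow_four hβ.le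
  have hb6 : b ^ 6 * θ = 1 := beta_rpow_quarter_pow_six hθ
  refine ⟨C * ((b : ℂ)⁻¹ * exp (-(2 / (3 * θ) * I))),
    mul_ne_zero hC0 (mul_ne_zero (inv_ne_zero hb0') (exp_ne_zero _)), ?_⟩
  have hq : Tendsto (fun x : ℝ => b * (1 + θ * x) ^ (1 / 4 : ℝ)) atTop atTop :=
    (tendsto_rpow_quarter_atTop.comp
      (tendsto_atTop_add_const_left _ 1 (tendsto_id.const_mul_atTop hθ))).const_mul_atTop hb0
  refine ((hC.comp hq).mul_const ((b : ℂ)⁻¹ * exp (-(2 / (3 * θ) * I)))).congr' ?_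
  filter_upwards [eventually_ge_atTop 0] with x hx
  have hy : 0 < 1 + θ * x := by positivity
  rw [rampWave_of_nonneg hθ isRotatedAiry_wPlus 0 hx, rampVar_zero_left, wPlus_eq, wkbRight,
    sqrt_speed_of_nonneg hθ hx, phase_of_nonneg hθ hx, Function.comp_apply]
  have hr4 := rpow_quarter_pow_four hy.le
  have hr0 : 0 < (1 + θ * x) ^ (1 / 4 : ℝ) := Real.rpow_pos_of_pos hy _
  set r := (1 + θ * x) ^ (1 / 4 : ℝ)
  have hr0' : (r : ℂ) ≠ 0 := ofReal_ne_zero.2 hr0.ne'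
  have harg : (beta θ : ℂ) * (1 + (θ : ℂ) * x) = ((b * r : ℝ) : ℂ) ^ 4 := by
    have : beta θ * (1 + θ * x) = (b * r) ^ 4 := by rw [mul_pow, hb4, hr4]
    exact_mod_cast this
  have hexp : exp (2 / 3 * rotPlus ^ 3 * ((b * r : ℝ) : ℂ) ^ 6) * exp (-(2 / (3 * θ) * I))
      = (exp (-(I * ((2 / (3 * θ) * (r ^ 6 - 1) : ℝ) : ℂ))))⁻¹ := by
    rw [← exp_neg, ← exp_add, rotPlus_pow_three]
    congr 1
    have h6 : (b : ℂ) ^ 6 * θ = 1 := by exact_mod_cast hb6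
    push_cast
    field_simp
    linear_combination (r : ℂ) ^ 6 * h6
  beta_reduce
  rw [harg, div_eq_mul_inv (airyAi _), mul_inv, ← hexp]
  generalize exp (2 / 3 * rotPlus ^ 3 * ((b * r : ℝ) : ℂ) ^ 6) = e₁
  generalize airyAi (rotPlus ^ 2 * ((b * r : ℝ) : ℂ) ^ 4) = a
  push_cast
  field_simp

/-- A line of functions contains exactly one element asymptotic to `v`, provided that its generator
is asymptotic to a nonzero multiple of `v`. -/
lemma mem_span_and_tendsto_div_iff {e v : ℝ → ℂ} {l : Filter ℝ} [l.NeBot] {C : ℂ} (hC : C ≠ 0)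
    (h : Tendsto (fun x => e x / v x) l (𝓝 C)) (u : ℝ → ℂ) :
    (u ∈ Submodule.span ℂ {e} ∧ Tendsto (fun x => u x / v x) l (𝓝 1)) ↔ u = C⁻¹ • e := by
  have hmul : ∀ a : ℂ, Tendsto (fun x => (a • e) x / v x) l (𝓝 (a * C)) := fun a =>
    (h.const_mul a).congr fun x => by simp [mul_div_assoc]
  constructor
  · rintro ⟨hu, hlim⟩
    obtain ⟨a, rfl⟩ := Submodule.mem_span_singleton.1 hu
    rw [eq_inv_of_mul_eq_one_left (tendsto_nhds_unique (hmul a) hlim)]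
  · rintro rfl
    refine ⟨Submodule.smul_mem _ _ (Submodule.mem_span_singleton_self e), ?_⟩
    simpa [hC] using hmul C⁻¹

lemma isNormalizedOutgoingAtBot_iff {θ : ℝ} (hθ : 0 < θ) (u : ℝ → ℂ) :
    IsNormalizedOutgoingAtBot 1 θ u ↔ u = expWave θ (1 : ℝ) 0 := by
  have h : Tendsto (fun x => expWave θ (1 : ℝ) 0 x / wkbLeft 1 θ x) atBot (𝓝 1) := by
    refine tendsto_const_nhds.congr' ?_
    filter_upwards [eventually_le_atBot 0] with x hx
    rw [expWave_of_nonpos θ (by norm_num) 0 hx, wkbLeft_of_nonpos hx, waveNumber_zero]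
    simp
  rw [IsNormalizedOutgoingAtBot, outgoingAtBot_eq_span hθ,
    mem_span_and_tendsto_div_iff one_ne_zero h, inv_one, one_smul]

lemma isNormalizedIncomingAtBot_iff {θ : ℝ} (hθ : 0 < θ) (u : ℝ → ℂ) :
    IsNormalizedIncomingAtBot 1 θ u ↔ u = expWave θ (-1 : ℝ) 0 := by
  have h : Tendsto (fun x => expWave θ (-1 : ℝ) 0 x / wkbRight 1 θ x) atBot (𝓝 1) := by
    refine tendsto_const_nhds.congr' ?_
    filter_upwards [eventually_le_atBot 0] with x hx
    rw [expWave_of_nonpos θ (by norm_num) 0 hx, wkbRight_of_nonpos hx, waveNumber_zero]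
    simp
  rw [IsNormalizedIncomingAtBot, incomingAtBot_eq_span hθ,
    mem_span_and_tendsto_div_iff one_ne_zero h, inv_one, one_smul]

/-! ### The reflection coefficient -/

lemma rampWave_apply_zero (θ : ℝ) (w : ℂ → ℂ) : rampWave θ w 0 0 = w (beta θ) := by
  rw [rampWave, cauchySol_zero, rampVar_zero_zero]

lemma deriv_rampWave_zero {θ : ℝ} (hθ : 0 < θ) (w : ℂ → ℂ) :
    deriv (rampWave θ w 0) 0 = (beta θ : ℂ) * θ * deriv w (beta θ) := by
  rw [rampWave, deriv_cauchySol_zero hθ, rampVar_zero_zero, rampVarDeriv, waveNumberCbrt_zero]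
  ring

/-- The energy inequality for the decaying waves with `σ < 0` survives the limit `σ → 0⁻`: the
energy flux of the wave outgoing to `+∞` through `x = 0` has a sign. -/
lemma inner_rampWave_wPlus_nonpos {θ : ℝ} (hθ : 0 < θ) :
    inner ℝ (I * rampWave θ wPlus 0 0) (deriv (rampWave θ wPlus 0) 0) ≤ 0 := by
  set F : ℝ → ℝ := fun σ => inner ℝ (I * waveNumber σ * wPlus (rampVar θ σ 0))
    (rampVarDeriv θ σ * deriv wPlus (rampVar θ σ 0)) with hF
  have hval : ∀ σ, F σ =
      inner ℝ (I * waveNumber σ * rampWave θ wPlus σ 0) (deriv (rampWave θ wPlus σ) 0) := by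
    intro σ
    rw [rampWave, cauchySol_zero, deriv_cauchySol_zero hθ]
  have hcont : Continuous F := by
    have h1 : Continuous fun σ : ℝ => rampVar θ σ 0 := by
      have := continuous_waveNumberCbrt
      unfold rampVar
      fun_prop
    have h2 := continuous_rampVarDeriv θ
    have h3 := isRotatedAiry_wPlus.continuous.comp h1
    have h4 := isRotatedAiry_wPlus.continuous_deriv.comp h1
    exact ((continuous_const.mul continuous_waveNumber).mul h3).inner ((h2.mul h4))
  have h0 : F 0 ≤ 0 := by
    refine le_of_tendsto ((hcont.tendsto 0).mono_left (nhdsWithin_le_nhds (s := Set.Iio 0))) ?_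
    filter_upwards [self_mem_nhdsWithin] with σ hσ
    rw [hval]
    refine (isSolution_rampWave hθ wPlus σ).inner_nonpos hθ (tendsto_rampWave_wPlus hθ hσ) ?_ ?_
    · rw [mul_pow, I_sq]
      ring
    · simpa [waveNumber] using hσ
  rwa [hval, waveNumber_zero, mul_one] at h0

/-- The outgoing wave has a nonzero incident part: a wave equal to a multiple of `e^{ix}` on
`x ≤ 0` carries energy in the wrong direction. -/
lemma neg_deriv_wPlus_add_ne_zero {θ : ℝ} (hθ : 0 < θ) :
    -deriv wPlus (beta θ : ℂ) + I * ((beta θ ^ (1 / 2 : ℝ) : ℝ) : ℂ) * wPlus (beta θ : ℂ) ≠ 0 := by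
  intro h
  have hs : ((beta θ ^ (1 / 2 : ℝ) : ℝ) : ℂ) * ((beta θ : ℂ) * θ) = 1 := by
    exact_mod_cast beta_rpow_half hθ
  have hd : deriv (rampWave θ wPlus 0) 0 = I * rampWave θ wPlus 0 0 := by
    rw [deriv_rampWave_zero hθ, rampWave_apply_zero]
    linear_combination (-((beta θ : ℂ) * θ)) * h + I * wPlus (beta θ) * hs
  have hE := inner_rampWave_wPlus_nonpos hθ
  rw [hd, real_inner_self_eq_norm_sq, norm_mul, norm_I, one_mul] at hE
  have h0 : rampWave θ wPlus 0 0 = 0 := by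
    rw [← norm_eq_zero]
    exact pow_eq_zero_iff two_ne_zero |>.1 (le_antisymm hE (sq_nonneg _))
  refine rampWave_wPlus_ne_zero hθ ((isSolution_rampWave hθ wPlus 0).ext hθ
    (IsSolution.zero 1 θ 0) h0 ?_)
  rw [hd, h0, mul_zero]
  exact (deriv_const (0 : ℝ) (0 : ℂ)).symm

lemma isReflectionCoefficient_iff {θ : ℝ} (hθ : 0 < θ) (R : ℂ) :
    IsReflectionCoefficient 1 θ R ↔
      R = (deriv wPlus (beta θ : ℂ) +
          I * ((beta θ ^ (1 / 2 : ℝ) : ℝ) : ℂ) * wPlus (beta θ : ℂ)) /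
        (-deriv wPlus (beta θ : ℂ) +
          I * ((beta θ ^ (1 / 2 : ℝ) : ℝ) : ℂ) * wPlus (beta θ : ℂ)) := by
  obtain ⟨C, hC0, hC⟩ := exists_tendsto_rampWave_div_wkbRight hθ
  have htop : ∀ u, IsNormalizedOutgoingAtTop 1 θ u ↔ u = C⁻¹ • rampWave θ wPlus 0 := fun u => by
    rw [IsNormalizedOutgoingAtTop, outgoingAtTop_eq_span hθ, mem_span_and_tendsto_div_iff hC0 hC]
  have hD := neg_deriv_wPlus_add_ne_zero hθ
  have hs : ((beta θ ^ (1 / 2 : ℝ) : ℝ) : ℂ) * ((beta θ : ℂ) * θ) = 1 := by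
    exact_mod_cast beta_rpow_half hθ
  have hr := isSolution_expWave hθ ((1 : ℝ) : ℂ) 0
  have hi := isSolution_expWave hθ ((-1 : ℝ) : ℂ) 0
  have ht := (isSolution_rampWave hθ wPlus 0).smul C⁻¹
  -- the decomposition of the outgoing wave is equivalent to two linear equations at `x = 0`
  have hdec : ∀ A B : ℂ, C⁻¹ • rampWave θ wPlus 0
      = A • expWave θ (1 : ℝ) 0 + B • expWave θ (-1 : ℝ) 0 ↔
      C⁻¹ * wPlus (beta θ) = A + B ∧
        C⁻¹ * ((beta θ : ℂ) * θ * deriv wPlus (beta θ)) = A * I - B * I := by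
    intro A B
    have e1 : (C⁻¹ • rampWave θ wPlus 0) 0 = C⁻¹ * wPlus (beta θ) := by
      rw [Pi.smul_apply, smul_eq_mul, rampWave_apply_zero]
    have e2 : deriv (C⁻¹ • rampWave θ wPlus 0) 0
        = C⁻¹ * ((beta θ : ℂ) * θ * deriv wPlus (beta θ)) := by
      rw [← deriv_rampWave_zero hθ]
      exact (((isSolution_rampWave hθ wPlus 0).1 0).hasDerivAt.const_smul C⁻¹).deriv
    have e3 : (A • expWave θ (1 : ℝ) 0 + B • expWave θ (-1 : ℝ) 0) 0 = A + B := by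
      simp [expWave_apply_zero]
    have e4 : deriv (A • expWave θ (1 : ℝ) 0 + B • expWave θ (-1 : ℝ) 0) 0
        = A * I - B * I := by
      rw [hr.deriv_smul_add_smul_zero hi, deriv_expWave_zero hθ, deriv_expWave_zero hθ]
      push_cast
      ring
    rw [← e1, ← e2, ← e3, ← e4]
    exact ⟨fun h => ⟨congrFun h 0, by rw [h]⟩, fun h =>
      ht.ext hθ ((hr.smul A).add (hi.smul B)) h.1 h.2⟩
  generalize ((beta θ ^ (1 / 2 : ℝ) : ℝ) : ℂ) = s at hs hD ⊢
  have hs0 : s ≠ 0 := left_ne_zero_of_mul_eq_one hs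
  have hI := I_ne_zero
  generalize wPlus (beta θ) = w at hdec hD ⊢
  generalize deriv wPlus (beta θ) = w' at hdec hD ⊢
  constructor
  · rintro ⟨ut, ur, ui, A, B, hut, hur, hui, heq, hB, rfl⟩
    rw [htop] at hut
    rw [isNormalizedOutgoingAtBot_iff hθ] at hur
    rw [isNormalizedIncomingAtBot_iff hθ] at hui
    subst hut hur hui
    obtain ⟨h1, h2⟩ := (hdec A B).1 heq
    have hw : w = C * (A + B) := by rw [← h1, mul_inv_cancel_left₀ hC0]
    have hw' : w' = s * (C * (A * I - B * I)) := by
      rw [← h2, mul_inv_cancel_left₀ hC0]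
      linear_combination (-w') * hs
    rw [div_eq_div_iff hB hD, hw, hw']
    ring
  · rintro rfl
    refine ⟨_, _, _, C⁻¹ * ((w' + I * s * w) / (2 * I * s)),
      C⁻¹ * ((-w' + I * s * w) / (2 * I * s)),
      (htop _).2 rfl, (isNormalizedOutgoingAtBot_iff hθ _).2 rfl,
      (isNormalizedIncomingAtBot_iff hθ _).2 rfl, (hdec _ _).2 ⟨?_, ?_⟩, ?_, ?_⟩
    · field_simp
      ring
    · field_simp
      linear_combination (2 * w') * hs
    · exact mul_ne_zero (inv_ne_zero hC0) (div_ne_zero hD (by simp [hs0]))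
    · rw [mul_div_mul_left _ _ (inv_ne_zero hC0), div_div_div_cancel_right₀ (by simp [hs0])]

end Reflection

end RampReflection

theorem mainTheorem8 (θ : ℝ) (hθ : 0 < θ) :
    -- `w₊(β(1 + θx))` spans the space of waves outgoing to `+∞`
    ((∃! u : ℝ → ℂ, RampReflection.IsRampSolutionOf θ RampReflection.wPlus u) ∧
      ∀ u : ℝ → ℂ, RampReflection.IsRampSolutionOf θ RampReflection.wPlus u →
        u ≠ 0 ∧ RampReflection.outgoingAtTop 1 θ = Submodule.span ℂ {u}) ∧
    -- `w₋(β(1 + θx))` spans the space of waves incoming from `+∞`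
    ((∃! u : ℝ → ℂ, RampReflection.IsRampSolutionOf θ RampReflection.wMinus u) ∧
      ∀ u : ℝ → ℂ, RampReflection.IsRampSolutionOf θ RampReflection.wMinus u →
        u ≠ 0 ∧ RampReflection.incomingAtTop 1 θ = Submodule.span ℂ {u}) ∧
    -- the reflection coefficient
    (-deriv RampReflection.wPlus (RampReflection.beta θ : ℂ) +
        Complex.I * ((RampReflection.beta θ ^ (1 / 2 : ℝ) : ℝ) : ℂ) *
          RampReflection.wPlus (RampReflection.beta θ : ℂ) ≠ 0 ∧
      ∀ R : ℂ, RampReflection.IsReflectionCoefficient 1 θ R ↔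
        R = (deriv RampReflection.wPlus (RampReflection.beta θ : ℂ) +
              Complex.I * ((RampReflection.beta θ ^ (1 / 2 : ℝ) : ℝ) : ℂ) *
                RampReflection.wPlus (RampReflection.beta θ : ℂ)) /
            (-deriv RampReflection.wPlus (RampReflection.beta θ : ℂ) +
              Complex.I * ((RampReflection.beta θ ^ (1 / 2 : ℝ) : ℝ) : ℂ) *
                RampReflection.wPlus (RampReflection.beta θ : ℂ))) := by
  have hp := RampReflection.isRampSolutionOf_iff hθ RampReflection.isRotatedAiry_wPlus
  have hm := RampReflection.isRampSolutionOf_iff hθ RampReflection.isRotatedAiry_wMinus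
  refine ⟨⟨⟨_, (hp _).2 rfl, fun u hu => (hp u).1 hu⟩, fun u hu => ?_⟩,
    ⟨⟨_, (hm _).2 rfl, fun u hu => (hm u).1 hu⟩, fun u hu => ?_⟩,
    RampReflection.neg_deriv_wPlus_add_ne_zero hθ, RampReflection.isReflectionCoefficient_iff hθ⟩
  · rw [(hp u).1 hu]
    exact ⟨RampReflection.rampWave_wPlus_ne_zero hθ, RampReflection.outgoingAtTop_eq_span hθ⟩
  · rw [(hm u).1 hu]
    exact ⟨RampReflection.rampWave_wMinus_ne_zero hθ, RampReflection.incomingAtTop_eq_span hθ⟩
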